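/- **Theorem C.4.** Let $f_i=1/i$ for $i\in[n]$ (Zipfian frequencies). For $n,B,k\in\mathbb N$ with $k$ odd, CountSketch with $k$ rows of width $B$ draws hash functions $h_1,\dots,h_k:[n]\to[B]$ and sign functions $s_1,\dots,s_k:[n]\to\{-1,1\}$ independently and uniformly among all such functions, and estimates $f_i$ by $$\tilde f_i=\operatorname{median}_{\ell\in[k]}\; s_\ell(i)\sum_{j\in[n]}[h_\ell(j)=h_\ell(i)]\,s_\ell(j)f_j .$$ There are universal constants $c,C>0$ such that for all odd $k\ge 3$, all $B\ge k$, all $n\ge kB$ and all $i\in[n]$, $$\frac{c}{B\sqrt k\,\log k}\;\le\;\mathbb E\big[|\tilde f_i-f_i|\big]\;\le\;\frac{C}{B\sqrt k}.$$ Consequently, a constant number of rows is asymptotically optimal at fixed total space: for every odd $k_0\ge3$ there is a constant $D>0$ depending only on $k_0$ such that for all $n\ge S$ with $\lfloor S/k_0\rfloor\ge k_0$, and all odd $k\ge3$ with $\lfloor S/k\rfloor\ge k$, the expected error $\mathbb E[|\tilde f_i-f_i|]$ of CountSketch with $k_0$ rows of width $\lfloor S/k_0\rfloor$ is, for every $i\in[n]$,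 at most $D$ times that of CountSketch with $k$ rows of width $\lfloor S/k\rfloor$; the same holds, with the same $D$, for the expected weighted error $\mathbb E\big[\frac1N\sum_{i\in[n]}f_i|\tilde f_i-f_i|\big]$, where $N=\sum_{i\in[n]}f_i$. -/

import Mathlib

open scoped BigOperators

namespace CountSketch

/-- The Zipfian frequencies on `n` items. The item `i : Fin n` is the item of rank `i + 1`. -/
noncomputable def zipf (n : ℕ) (i : Fin n) : ℝ := 1 / ((i : ℝ) + 1)

/-- The median of a `k`-tuple of reals, for odd `k`: the middle entry of the sorted tuple. -/
noncomputable def median {k : ℕ} (x : Fin k → ℝ) : ℝ :=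
  if hk : 0 < k then x (Tuple.sort x ⟨k / 2, Nat.div_lt_self hk one_lt_two⟩) else 0

/-- The random choices of a sketch with `k` rows of width `B` on `n` items: `k` hash functions
`[n] → [B]` and `k` sign functions `[n] → {-1, 1}`. The functions are truly random and independent
exactly when an element of this finite type is drawn uniformly. -/
abbrev Seed (n B k : ℕ) : Type := (Fin k → Fin n → Fin B) × (Fin k → Fin n → ℤˣ)

/-- The content of bucket `b` of row `l`, after the frequency vector `f` has been inserted. -/
noncomputable def table {n B k : ℕ} (f : Fin n → ℝ) (ω : Seed n B k) (l : Fin k) (b : Fin B) : ℝ :=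
  ∑ j : Fin n, if ω.1 l j = b then (((ω.2 l j : ℤ)) : ℝ) * f j else 0

/-- The estimate of the frequency of item `i`: the median over the rows of the content of the
bucket of `i`, multiplied by the sign of `i` in that row. -/
noncomputable def estimate {n B k : ℕ} (f : Fin n → ℝ) (ω : Seed n B k) (i : Fin n) : ℝ :=
  median fun l => (((ω.2 l i : ℤ)) : ℝ) * table f ω l (ω.1 l i)

/-- The expected error on item `i` for Zipfian frequencies; `𝔼 ω` is the expectation under the
uniform distribution on the finite type of random choices. -/
noncomputable def expectedError (n B k : ℕ) (i : Fin n) : ℝ :=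
  𝔼 ω : Seed n B k, |estimate (zipf n) ω i - zipf n i|

/-- The expected weighted error `(1 / N) ∑ i, f i * |estimate of f i - f i|`, `N = ∑ i, f i`,
for Zipfian frequencies. -/
noncomputable def expectedWeightedError (n B k : ℕ) : ℝ :=
  𝔼 ω : Seed n B k,
    (1 / ∑ i, zipf n i) * ∑ i, zipf n i * |estimate (zipf n) ω i - zipf n i|

end CountSketch

/-! One row estimates $f_i$ by $f_i+X$, where $X$ (`rowError`) is symmetric and has characteristic
function $\varphi(u)=\prod_{j\ne i}(1-(1-\cos(u f_j))/B)$. For $f_j=1/j$ the sum of $1-\cos(u/j)$ is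
of order $u$, so $X$ resembles a Cauchy variable of scale $1/B$: $1-\varphi(u)\le 8u/B$, and
$\varphi(u)\le 2e^{-u/(15B)}$ for $0\le u\le n$. Smoothing inequalities turn this into a tail of
order at most $1/(tB)$ and a small-ball probability of order $tB$, from below up to saturation and
from above for $t\ge 1/n$.

Upper bound: the median of $k=2m+1$ rows is off by more than $t$ only if most rows are off to the
same side. With $q=P(|X|>t)$ and $r=1-q$, a Chernoff bound gives at most $2q(1-r^2)^m$
(`prob_lt_abs_median_le`), which is $O(1/(t^2B^2k))$; a tail of order $t^{-2}$ sums to an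
expectation $O(1/(B\sqrt k))$.

Lower bound: for $t$ a small multiple of $1/(B\sqrt k)$, the expected number of rows with error at
most $t$ is a small multiple of $\sqrt k$, while the signs of the other rows form a random walk of
size about $\sqrt k$, which outweighs them with constant probability
(`le_prob_lt_abs_median_of_cos`). For bounded $k$ it suffices that all rows err to one side. No
logarithm is lost here.

Fixed space: with $k_0$ rows the error is $O(\sqrt{k_0}/S)$. As $\log k=O(\sqrt k)$, even the lower
bound with the logarithm is of order at least $1/S$ for every $k$. -/

namespace CountSketch

/-! ### Probabilities on finite types -/

open Classical in
/-- The probability of an event under the uniform distribution on a finite type. -/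
noncomputable def prob {α : Type*} [Fintype α] (P : α → Prop) : ℝ :=
  𝔼 a, if P a then (1 : ℝ) else 0

section Prob

variable {α β : Type*} [Fintype α] [Fintype β]

lemma prob_nonneg (P : α → Prop) : 0 ≤ prob P :=
  Finset.expect_nonneg fun a _ => by split_ifs <;> norm_num

lemma prob_or_le (P Q : α → Prop) : prob (fun a => P a ∨ Q a) ≤ prob P + prob Q := by
  unfold prob
  rw [← Finset.expect_add_distrib]
  refine Finset.expect_le_expect fun a _ => ?_
  by_cases hP : P a <;> by_cases hQ : Q a <;> simp [hP, hQ]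

lemma prob_not [Nonempty α] (P : α → Prop) : prob (fun a => ¬ P a) = 1 - prob P := by
  unfold prob
  rw [eq_sub_iff_add_eq, ← Finset.expect_add_distrib]
  conv_rhs => rw [← Fintype.expect_const (ι := α) (1 : ℝ)]
  refine Finset.expect_congr rfl fun a _ => ?_
  by_cases hP : P a <;> simp [hP]

lemma prob_le_one [Nonempty α] (P : α → Prop) : prob P ≤ 1 := by
  have := prob_nonneg (fun a => ¬ P a)
  rw [prob_not] at this
  linarith

lemma prob_comp_equiv (e : α ≃ β) (P : β → Prop) : prob (fun a => P (e a)) = prob P :=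
  Fintype.expect_equiv e _ _ fun _ => rfl

/-- Expectations of products over independent coordinates. -/
lemma expect_pi_prod {ι : Type*} [Fintype ι] [DecidableEq ι] {𝕜 : Type*} [Field 𝕜] [CharZero 𝕜]
    (F : ι → α → 𝕜) : 𝔼 ρ : ι → α, ∏ l, F l (ρ l) = ∏ l, 𝔼 a, F l a := by
  simp only [Fintype.expect_eq_sum_div_card]
  rw [Finset.prod_div_distrib, Finset.prod_univ_sum, Fintype.piFinset_univ]
  simp

/-- Interval integrals commute with expectations. -/
lemma expect_intervalIntegral {F : α → ℝ → ℝ} {a b : ℝ} (hF : ∀ x, Continuous (F x)) :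
    𝔼 x, ∫ v in a..b, F x v = ∫ v in a..b, 𝔼 x, F x v := by
  simp only [Fintype.expect_eq_sum_div_card]
  rw [intervalIntegral.integral_div, intervalIntegral.integral_finsetSum]
  exact fun x _ => (hF x).intervalIntegrable _ _

open MeasureTheory in
lemma expect_integral {F : α → ℝ → ℝ} (hF : ∀ x, Integrable (F x)) :
    𝔼 x, ∫ v, F x v = ∫ v, 𝔼 x, F x v := by
  simp only [Fintype.expect_eq_sum_div_card]
  rw [integral_div, integral_finsetSum]
  exact fun x _ => hF x

/-- A discrete layer-cake bound: a tail bound of order `t⁻²` bounds the expectation. -/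
lemma expect_le_of_prob_le [Nonempty α] {M : α → ℝ} {δ A : ℝ} (hM : ∀ a, 0 ≤ M a) (hδ : 0 < δ)
    (hA : 0 ≤ A) (h : ∀ t, 0 < t → prob (fun a => t < M a) ≤ A * (δ / t) ^ 2) :
    𝔼 a, M a ≤ (1 + 6 * A) * δ := by
  classical
  obtain ⟨N, hN⟩ : ∃ N : ℕ, ∀ a, M a / δ ≤ N := by
    obtain ⟨N, hN⟩ := exists_nat_ge (∑ a, M a / δ)
    exact ⟨N, fun a => (Finset.single_le_sum
      (fun b _ => div_nonneg (hM b) hδ.le) (Finset.mem_univ a)).trans hN⟩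
  -- A real number is at most the number of naturals strictly below it.
  have key : ∀ (N : ℕ) (y : ℝ), y ≤ N → y ≤ ∑ s ∈ Finset.range N, if (s : ℝ) < y then (1 : ℝ) else 0 := by
    intro N
    induction N with
    | zero => intro y hy; simpa using hy
    | succ N ih =>
      intro y hy
      rw [Finset.sum_range_succ]
      by_cases hyN : (N : ℝ) < y
      · have h1 : ∑ s ∈ Finset.range N, (if (s : ℝ) < y then (1 : ℝ) else 0) = N := by
          rw [Finset.sum_congr rfl (g := fun _ => (1 : ℝ))]
          · simp
          · intro s hs
            have : (s : ℝ) < N := by exact_mod_cast Finset.mem_range.1 hs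
            rw [if_pos (this.trans hyN)]
        rw [h1, if_pos hyN]
        push_cast at hy
        linarith
      · rw [if_neg hyN, add_zero]
        exact ih y (not_lt.1 hyN)
  have h1 : 𝔼 a, M a ≤ δ * ∑ s ∈ Finset.range N, prob (fun a => s * δ < M a) := by
    unfold prob
    rw [← Finset.expect_sum_comm, Finset.mul_expect]
    refine Finset.expect_le_expect fun a _ => ?_
    have := key N _ (hN a)
    rw [div_le_iff₀ hδ] at this
    refine this.trans (le_of_eq ?_)
    rw [mul_comm]
    congr 1
    refine Finset.sum_congr rfl fun s _ => ?_
    simp only [lt_div_iff₀ hδ]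
  -- The term $s=0$ is at most $1$. For $N\ge1$, $1/N^2\le 6/((N+1)(N+2))$, with equality at $N=1$,
  -- and the right side telescopes.
  have h2 : ∀ N : ℕ, ∑ s ∈ Finset.range N, prob (fun a => s * δ < M a) ≤ 1 + 6 * A - 6 * A / (N + 1) := by
    intro N
    induction N with
    | zero => simp
    | succ N ih =>
      rw [Finset.sum_range_succ]
      rcases Nat.eq_zero_or_pos N with rfl | hN0
      · simp only [Finset.range_zero, Finset.sum_empty, zero_add, Nat.cast_zero, zero_mul]
        have := prob_le_one (fun a => 0 < M a)
        push_cast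
        linarith
      · have hN' : (1 : ℝ) ≤ N := by exact_mod_cast hN0
        have h3 := h (N * δ) (by positivity)
        have h4 : A * (δ / (N * δ)) ^ 2 = A * (1 / N ^ 2) := by field_simp
        rw [h4] at h3
        push_cast
        have h5 : 6 * A / ((N : ℝ) + 1) - 6 * A / (N + 1 + 1) = A * (6 / ((N + 1) * (N + 2))) := by
          field_simp
          ring
        have h6 : 1 / (N : ℝ) ^ 2 ≤ 6 / ((N + 1) * (N + 2)) := by
          rw [div_le_div_iff₀ (by positivity) (by positivity)]
          nlinarith
        have h7 := mul_le_mul_of_nonneg_left h6 hA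
        linarith
  calc 𝔼 a, M a ≤ δ * (1 + 6 * A - 6 * A / (N + 1)) := h1.trans (by gcongr; exact h2 N)
    _ ≤ (1 + 6 * A) * δ := by
      have : 0 ≤ 6 * A / ((N : ℝ) + 1) := by positivity
      nlinarith

end Prob
/-! ### Smoothing inequalities for finite random variables -/

section Kernel

/-- The closed form shows that this kernel is nonnegative, bounded below near $0$ and small far out,
as both smoothing inequalities require. -/
lemma integral_triangle_mul_cos {y : ℝ} (hy : y ≠ 0) :
    ∫ v in (0 : ℝ)..1, (1 - v) * Real.cos (v * y) = (1 - Real.cos y) / y ^ 2 := by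
  have hd : ∀ v ∈ Set.uIcc (0 : ℝ) 1, HasDerivAt
      (fun v => (1 - v) * Real.sin (v * y) / y - Real.cos (v * y) / y ^ 2)
      ((1 - v) * Real.cos (v * y)) v := by
    intro v _
    have h0 : HasDerivAt (fun v : ℝ => v * y) y v := by
      simpa using (hasDerivAt_id v).mul_const y
    have h1 : HasDerivAt (fun v : ℝ => 1 - v) (-1) v := by
      simpa using (hasDerivAt_id v).const_sub 1
    have := ((h1.mul h0.sin).div_const y).sub (h0.cos.div_const (y ^ 2))
    refine this.congr_deriv ?_
    field_simp
    ring
  rw [intervalIntegral.integral_eq_sub_of_hasDerivAt hd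
    (Continuous.intervalIntegrable (by fun_prop) _ _)]
  simp
  ring

lemma integral_triangle : ∫ v in (0 : ℝ)..1, (1 - v) = 1 / 2 := by
  rw [intervalIntegral.integral_sub (by simp) (by simp)]
  norm_num

lemma integral_triangle_mul_cos_nonneg (y : ℝ) :
    0 ≤ ∫ v in (0 : ℝ)..1, (1 - v) * Real.cos (v * y) := by
  rcases eq_or_ne y 0 with rfl | hy
  · simp only [mul_zero, Real.cos_zero, mul_one, integral_triangle]; norm_num
  · rw [integral_triangle_mul_cos hy]
    have := Real.cos_le_one y
    exact div_nonneg (sub_nonneg.2 this) (sq_nonneg y)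

lemma le_integral_triangle_mul_cos {y : ℝ} (hy : |y| ≤ 1) :
    1 / 4 ≤ ∫ v in (0 : ℝ)..1, (1 - v) * Real.cos (v * y) := by
  rcases eq_or_ne y 0 with rfl | hy0
  · simp only [mul_zero, Real.cos_zero, mul_one, integral_triangle]; norm_num
  · rw [integral_triangle_mul_cos hy0]
    have h1 := (abs_le.1 (Real.cos_bound hy)).2
    have h2 : |y| ^ 4 ≤ y ^ 2 := by
      rw [← sq_abs y]
      exact pow_le_pow_of_le_one (abs_nonneg y) hy (by norm_num)
    rw [le_div_iff₀ (by positivity)]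
    linarith [sq_nonneg y]

lemma integral_triangle_mul_cos_le (y : ℝ) :
    ∫ v in (0 : ℝ)..1, (1 - v) * Real.cos (v * y) ≤ 1 / 2 := by
  rw [← integral_triangle]
  refine intervalIntegral.integral_mono_on zero_le_one
    (Continuous.intervalIntegrable (by fun_prop) _ _)
    (Continuous.intervalIntegrable (by fun_prop) _ _) fun v hv => ?_
  exact mul_le_of_le_one_right (sub_nonneg.2 hv.2) (Real.cos_le_one _)

lemma integral_triangle_mul_cos_le_of_le {y : ℝ} (hy : 3 ≤ |y|) :
    ∫ v in (0 : ℝ)..1, (1 - v) * Real.cos (v * y) ≤ 2 / 9 := by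
  have hy0 : y ≠ 0 := by rintro rfl; norm_num at hy
  rw [integral_triangle_mul_cos hy0]
  have h1 := Real.neg_one_le_cos y
  have h2 : 9 ≤ y ^ 2 := by rw [← sq_abs]; nlinarith
  rw [div_le_div_iff₀ (by positivity) (by norm_num)]
  linarith

open MeasureTheory in
lemma integrable_cos_mul_gaussian {b : ℝ} (hb : 0 < b) (y : ℝ) :
    Integrable fun u : ℝ => Real.cos (u * y) * Real.exp (-b * u ^ 2) := by
  refine (integrable_exp_neg_mul_sq hb).mono' (by fun_prop) (ae_of_all _ fun u => ?_)
  rw [Real.norm_eq_abs, abs_mul, abs_of_pos (Real.exp_pos _)]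
  exact mul_le_of_le_one_left (Real.exp_pos _).le (Real.abs_cos_le_one _)

/-- The Fourier transform of a Gaussian, in real form. -/
lemma integral_cos_mul_gaussian {b : ℝ} (hb : 0 < b) (y : ℝ) :
    ∫ u : ℝ, Real.cos (u * y) * Real.exp (-b * u ^ 2) =
      Real.sqrt (Real.pi / b) * Real.exp (-y ^ 2 / (4 * b)) := by
  have h := fourierIntegral_gaussian (b := (b : ℂ)) (by simpa using hb) (y : ℂ)
  have hint : MeasureTheory.Integrable fun u : ℝ =>
      Complex.exp (Complex.I * y * u) * Complex.exp (-b * (u : ℂ) ^ 2) := by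
    have := integrable_cexp_quadratic (b := (b : ℂ)) (by simpa using hb) (Complex.I * y) 0
    refine this.congr (MeasureTheory.ae_of_all _ fun u => ?_)
    simp only [← Complex.exp_add]
    congr 1
    ring
  have h2 := congrArg Complex.re h
  rw [← RCLike.re_eq_complex_re, ← integral_re hint] at h2
  have h3 : ∀ u : ℝ, RCLike.re (Complex.exp (Complex.I * y * u) * Complex.exp (-b * (u : ℂ) ^ 2)) =
      Real.cos (u * y) * Real.exp (-b * u ^ 2) := by
    intro u
    rw [RCLike.re_eq_complex_re, show Complex.I * y * u = ((u * y : ℝ) : ℂ) * Complex.I by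
      push_cast; ring, show -(b : ℂ) * (u : ℂ) ^ 2 = ((-b * u ^ 2 : ℝ) : ℂ) by push_cast; ring,
      ← Complex.ofReal_exp, Complex.re_mul_ofReal, Complex.exp_ofReal_mul_I_re]
  simp only [h3] at h2
  rw [h2, RCLike.re_eq_complex_re, show (Real.pi : ℂ) / b = ((Real.pi / b : ℝ) : ℂ) by push_cast; ring,
    show (1 / 2 : ℂ) = ((1 / 2 : ℝ) : ℂ) by push_cast; ring,
    ← Complex.ofReal_cpow (by positivity),
    show -(y : ℂ) ^ 2 / (4 * b) = ((-y ^ 2 / (4 * b) : ℝ) : ℂ) by push_cast; ring,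
    ← Complex.ofReal_exp, ← Complex.ofReal_mul, Complex.ofReal_re, Real.sqrt_eq_rpow]

/-- A combination of Gaussians that is bounded by `4` near `0`, nonpositive elsewhere, and has a
nonnegative Fourier transform. -/
lemma integral_cos_mul_gaussian_sub (y : ℝ) :
    ∫ u : ℝ, (2 * (Real.cos (u * y) * Real.exp (-(1 / 4) * u ^ 2)) -
      Real.cos (u * y) * Real.exp (-1 * u ^ 2)) =
      Real.sqrt Real.pi * (4 * Real.exp (-y ^ 2) - Real.exp (-y ^ 2 / 4)) := by
  rw [MeasureTheory.integral_sub ((integrable_cos_mul_gaussian (by norm_num) y).const_mul 2)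
    (integrable_cos_mul_gaussian one_pos y), MeasureTheory.integral_const_mul,
    integral_cos_mul_gaussian (by norm_num), integral_cos_mul_gaussian one_pos,
    show Real.pi / (1 / 4) = 2 ^ 2 * Real.pi by ring, Real.sqrt_mul (by positivity),
    Real.sqrt_sq (by norm_num)]
  norm_num
  ring

lemma four_mul_exp_sub_le (y : ℝ) :
    4 * Real.exp (-y ^ 2) - Real.exp (-y ^ 2 / 4) ≤ if |y| ≤ 2 then 4 else 0 := by
  split_ifs with h
  · have h1 : Real.exp (-y ^ 2) ≤ 1 := Real.exp_le_one_iff.2 (by nlinarith)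
    linarith [Real.exp_pos (-y ^ 2 / 4)]
  · have h2 : 4 ≤ y ^ 2 := by rw [← sq_abs]; nlinarith
    have h3 : Real.exp (-y ^ 2 / 4) = Real.exp (-y ^ 2) * Real.exp (3 / 4 * y ^ 2) := by
      rw [← Real.exp_add]; congr 1; ring
    have h4 : 4 ≤ Real.exp (3 / 4 * y ^ 2) := by
      linarith [Real.add_one_le_exp (3 / 4 * y ^ 2)]
    rw [h3]
    nlinarith [Real.exp_pos (-y ^ 2)]

variable {α : Type*} [Fintype α]

/-- Smoothing inequality: small-ball probabilities are at most an average of the characteristic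
function. -/
lemma prob_abs_le_le_integral (X : α → ℝ) {t : ℝ} (ht : 0 < t) :
    prob (fun a => |X a| ≤ t) ≤
      4 * ∫ v in (0 : ℝ)..1, (1 - v) * 𝔼 a, Real.cos (v / t * X a) := by
  simp only [Finset.mul_expect]
  rw [← expect_intervalIntegral (fun a => by fun_prop), Finset.mul_expect]
  refine Finset.expect_le_expect fun a _ => ?_
  have h : ∀ v : ℝ, v / t * X a = v * (X a / t) := fun v => by ring
  simp only [h]
  split_ifs with hX
  · have := le_integral_triangle_mul_cos (y := X a / t)
      (by rwa [abs_div, abs_of_pos ht, div_le_one ht])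
    linarith
  · linarith [integral_triangle_mul_cos_nonneg (X a / t)]

/-- Smoothing inequality: tail probabilities are controlled by the characteristic function near
zero. -/
lemma prob_lt_abs_le_integral [Nonempty α] (X : α → ℝ) {t : ℝ} (ht : 0 < t) :
    5 / 18 * prob (fun a => t < |X a|) ≤
      ∫ v in (0 : ℝ)..1, (1 - v) * (1 - 𝔼 a, Real.cos (3 * v / t * X a)) := by
  have h0 : ∀ v : ℝ, (1 - v) * (1 - 𝔼 a, Real.cos (3 * v / t * X a)) =
      𝔼 a, ((1 - v) - (1 - v) * Real.cos (v * (3 * X a / t))) := by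
    intro v
    rw [Finset.expect_sub_distrib, Fintype.expect_const, ← Finset.mul_expect, mul_sub, mul_one]
    congr 3
    ext a
    congr 1
    ring
  simp only [h0]
  rw [← expect_intervalIntegral (fun a => by fun_prop), prob, Finset.mul_expect]
  refine Finset.expect_le_expect fun a _ => ?_
  rw [intervalIntegral.integral_sub (Continuous.intervalIntegrable (by fun_prop) _ _)
    (Continuous.intervalIntegrable (by fun_prop) _ _), integral_triangle]
  -- For $|X|>t$ the kernel is at most $2/9$ instead of its maximum $1/2$; the gap is $5/18$.
  split_ifs with hX
  · have := integral_triangle_mul_cos_le_of_le (y := 3 * X a / t)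
      (by rw [abs_div, abs_mul, abs_of_pos ht, le_div_iff₀ ht, abs_of_pos (by norm_num : (0:ℝ) < 3)]
          linarith)
    linarith
  · linarith [integral_triangle_mul_cos_le (3 * X a / t)]

/-- Exponential decay of the characteristic function up to `1 / t` gives anti-concentration at
scale `t`. -/
lemma prob_abs_le_le (X : α → ℝ) {t κ : ℝ} (ht : 0 < t) (hκ : 0 < κ)
    (h : ∀ u, 0 ≤ u → u ≤ 1 / t → 𝔼 a, Real.cos (u * X a) ≤ 2 * Real.exp (-κ * u)) :
    prob (fun a => |X a| ≤ t) ≤ 8 * t / κ := by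
  have hc : Continuous fun v : ℝ => 𝔼 a, Real.cos (v / t * X a) := by
    simp only [Fintype.expect_eq_sum_div_card]
    fun_prop
  have hd : ∀ v ∈ Set.uIcc (0 : ℝ) 1, HasDerivAt
      (fun v => -(2 * t / κ) * Real.exp (-κ * (v / t))) (2 * Real.exp (-κ * (v / t))) v := by
    intro v _
    have h1 : HasDerivAt (fun v : ℝ => -κ * (v / t)) (-κ * (1 / t)) v :=
      ((hasDerivAt_id v).div_const t).const_mul (-κ)
    refine (h1.exp.const_mul (-(2 * t / κ))).congr_deriv ?_
    field_simp
  have h2 : ∫ v in (0 : ℝ)..1, (1 - v) * 𝔼 a, Real.cos (v / t * X a) ≤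
      ∫ v in (0 : ℝ)..1, 2 * Real.exp (-κ * (v / t)) := by
    refine intervalIntegral.integral_mono_on zero_le_one
      (Continuous.intervalIntegrable (by fun_prop) _ _)
      (Continuous.intervalIntegrable (by fun_prop) _ _) fun v hv => ?_
    have h3 := h (v / t) (div_nonneg hv.1 ht.le) (by gcongr; exact hv.2)
    have h4 := Real.exp_pos (-κ * (v / t))
    nlinarith [hv.1, hv.2]
  rw [intervalIntegral.integral_eq_sub_of_hasDerivAt hd
    (Continuous.intervalIntegrable (by fun_prop) _ _)] at h2
  have h5 := prob_abs_le_le_integral X ht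
  have h6 : 0 < 2 * t / κ * Real.exp (-κ * (1 / t)) := by positivity
  have h7 : 8 * t / κ = 4 * (2 * t / κ) := by ring
  simp only [zero_div, mul_zero, Real.exp_zero] at h2
  linarith

/-- A tail bound from a Lipschitz bound for the characteristic function at zero. -/
lemma prob_lt_abs_le [Nonempty α] (X : α → ℝ) {t L : ℝ} (ht : 0 < t) (hL : 0 ≤ L)
    (h : ∀ u, 0 ≤ u → 1 - 𝔼 a, Real.cos (u * X a) ≤ L * u) :
    prob (fun a => t < |X a|) ≤ 6 * L / t := by
  have hc : Continuous fun v : ℝ => 𝔼 a, Real.cos (3 * v / t * X a) := by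
    simp only [Fintype.expect_eq_sum_div_card]
    fun_prop
  have h2 : ∫ v in (0 : ℝ)..1, (1 - v) * (1 - 𝔼 a, Real.cos (3 * v / t * X a)) ≤
      ∫ v in (0 : ℝ)..1, (1 - v) * (3 * L / t) := by
    refine intervalIntegral.integral_mono_on zero_le_one
      (Continuous.intervalIntegrable (by fun_prop) _ _)
      (Continuous.intervalIntegrable (by fun_prop) _ _) fun v hv => ?_
    refine mul_le_mul_of_nonneg_left ?_ (sub_nonneg.2 hv.2)
    refine (h (3 * v / t) (div_nonneg (mul_nonneg zero_le_three hv.1) ht.le)).trans ?_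
    rw [← mul_div_assoc]
    exact div_le_div_of_nonneg_right (by nlinarith [hv.2]) ht.le
  rw [intervalIntegral.integral_mul_const, integral_triangle] at h2
  have h3 := prob_lt_abs_le_integral X ht
  have h4 : 0 ≤ L / t := by positivity
  have h5 : 3 * L / t = 3 * (L / t) := by ring
  have h6 : 6 * L / t = 6 * (L / t) := by ring
  rw [h5] at h2
  rw [h6]
  linarith

open MeasureTheory in
/-- A small-ball lower bound for variables with nonnegative characteristic function. -/
lemma le_prob_abs_le [Nonempty α] (X : α → ℝ) {t L : ℝ} (ht : 0 < t) (hL : 0 < L)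
    (h0 : ∀ u, 0 ≤ 𝔼 a, Real.cos (u * X a))
    (h : ∀ u, 0 ≤ u → 1 - 𝔼 a, Real.cos (u * X a) ≤ L * u) :
    min (t / (2 * L)) 1 / 40 ≤ prob (fun a => |X a| ≤ 2 * t) := by
  -- On $[0,\delta]$ the characteristic function at $u/t$ is at least $1/2$ and the Gaussian weight
  -- at least $e^{-1}$. Elsewhere the integrand is nonnegative and is discarded.
  set δ := min (t / (2 * L)) 1 with hδ
  have hδ0 : 0 ≤ δ := le_min (by positivity) zero_le_one
  set G : α → ℝ → ℝ := fun a u => 2 * (Real.cos (u * (X a / t)) * Real.exp (-(1 / 4) * u ^ 2)) -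
      Real.cos (u * (X a / t)) * Real.exp (-1 * u ^ 2) with hG
  have hGi : ∀ a, Integrable (G a) := fun a =>
    ((integrable_cos_mul_gaussian (by norm_num) _).const_mul 2).sub
      (integrable_cos_mul_gaussian one_pos _)
  have h1 : 𝔼 a, ∫ u, G a u ≤ Real.sqrt Real.pi * (4 * prob (fun a => |X a| ≤ 2 * t)) := by
    rw [prob, Finset.mul_expect, Finset.mul_expect]
    refine Finset.expect_le_expect fun a _ => ?_
    rw [hG, integral_cos_mul_gaussian_sub]
    refine mul_le_mul_of_nonneg_left ?_ (Real.sqrt_nonneg _)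
    refine (four_mul_exp_sub_le _).trans (le_of_eq ?_)
    simp only [abs_div, abs_of_pos ht, div_le_iff₀ ht]
    split_ifs <;> norm_num
  rw [expect_integral hGi] at h1
  have h2 : ∀ u, 𝔼 a, G a u = (𝔼 a, Real.cos (u / t * X a)) *
      (2 * Real.exp (-(1 / 4) * u ^ 2) - Real.exp (-1 * u ^ 2)) := by
    intro u
    rw [Finset.expect_mul]
    refine Finset.expect_congr rfl fun a _ => ?_
    simp only [hG]
    rw [show u / t * X a = u * (X a / t) by ring]
    ring
  have hw : ∀ u : ℝ, Real.exp (-1 * u ^ 2) ≤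
      2 * Real.exp (-(1 / 4) * u ^ 2) - Real.exp (-1 * u ^ 2) := by
    intro u
    have : Real.exp (-1 * u ^ 2) ≤ Real.exp (-(1 / 4) * u ^ 2) :=
      Real.exp_le_exp.2 (by nlinarith [sq_nonneg u])
    linarith
  have h3 : ∫ u in (0 : ℝ)..δ, (1 / 2 * Real.exp (-1) : ℝ) ≤ ∫ u, 𝔼 a, G a u := by
    rw [intervalIntegral.integral_of_le hδ0, ← integral_indicator measurableSet_Ioc]
    have hEi : Integrable fun u => 𝔼 a, G a u := by
      simp only [Fintype.expect_eq_sum_div_card]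
      exact (integrable_finsetSum _ fun a _ => hGi a).div_const _
    refine integral_mono ?_ hEi fun u => ?_
    · rw [integrable_indicator_iff measurableSet_Ioc]
      exact integrableOn_const (by simp)
    · simp only [h2]
      by_cases hu : u ∈ Set.Ioc 0 δ
      · rw [Set.indicator_of_mem hu]
        have hu1 : u ≤ 1 := hu.2.trans (min_le_right _ _)
        have hu2 : u ≤ t / (2 * L) := hu.2.trans (min_le_left _ _)
        have h4 := h (u / t) (div_nonneg hu.1.le ht.le)
        have h5 : L * (u / t) ≤ 1 / 2 := by
          rw [le_div_iff₀ (by positivity)] at hu2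
          rw [← mul_div_assoc, div_le_div_iff₀ ht two_pos]
          linarith
        refine mul_le_mul (by linarith) ((Real.exp_le_exp.2 ?_).trans (hw u)) (Real.exp_pos _).le
          (h0 _)
        nlinarith [hu.1]
      · rw [Set.indicator_of_notMem hu]
        exact mul_nonneg (h0 _) ((Real.exp_pos _).le.trans (hw u))
  rw [intervalIntegral.integral_const, smul_eq_mul, sub_zero] at h3
  have h4 : Real.sqrt Real.pi ≤ 1.8 := by
    rw [Real.sqrt_le_left (by norm_num)]
    linarith [Real.pi_lt_d2]
  have h5 : (1 / 2.72 : ℝ) ≤ Real.exp (-1) := by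
    rw [Real.exp_neg, ← one_div]
    exact one_div_le_one_div_of_le (Real.exp_pos 1) (by linarith [Real.exp_one_lt_d9])
  have h6 := prob_nonneg (fun a => |X a| ≤ 2 * t)
  have h7 : δ * (1 / 2 * (1 / 2.72)) ≤ 1.8 * (4 * prob (fun a => |X a| ≤ 2 * t)) :=
    calc δ * (1 / 2 * (1 / 2.72)) ≤ δ * (1 / 2 * Real.exp (-1)) := by gcongr
      _ ≤ Real.sqrt Real.pi * (4 * prob (fun a => |X a| ≤ 2 * t)) := h3.trans h1
      _ ≤ _ := by gcongr
  norm_num at h7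
  linarith

end Kernel
/-! ### Medians -/

section Median

variable {m : ℕ}

lemma card_filter_comp_sort {k : ℕ} (x : Fin k → ℝ) (P : ℝ → Prop) [DecidablePred P] :
    (Finset.univ.filter fun l => P (x (Tuple.sort x l))).card =
      (Finset.univ.filter fun l => P (x l)).card := by
  refine Finset.card_bij (fun l _ => Tuple.sort x l) (by simp) (by simp) fun l hl => ?_
  exact ⟨(Tuple.sort x).symm l, by simpa using hl, by simp⟩

lemma median_lt_iff (x : Fin (2 * m + 1) → ℝ) (t : ℝ) :
    median x < t ↔ m < (Finset.univ.filter fun l => x l < t).card := by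
  rw [median, dif_pos (by omega), ← card_filter_comp_sort x (· < t),
    ← Function.comp_apply (f := x), ← Tuple.lt_card_lt_iff_apply_lt_of_monotone (Tuple.monotone_sort x)]
  simp only [Function.comp_apply]
  rw [show (2 * m + 1) / 2 = m by omega]

lemma lt_median_iff (x : Fin (2 * m + 1) → ℝ) (t : ℝ) :
    t < median x ↔ m < (Finset.univ.filter fun l => t < x l).card := by
  have h1 : median x ≤ t ↔ m < (Finset.univ.filter fun l => x l ≤ t).card := by
    rw [median, dif_pos (by omega), ← card_filter_comp_sort x (· ≤ t),
      ← Function.comp_apply (f := x),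
      ← Tuple.lt_card_le_iff_apply_le_of_monotone (Tuple.monotone_sort x)]
    simp only [Function.comp_apply]
    rw [show (2 * m + 1) / 2 = m by omega]
  have h2 := Finset.card_filter_add_card_filter_not (s := (Finset.univ : Finset (Fin (2 * m + 1))))
    (fun l => x l ≤ t)
  simp only [not_le, Finset.card_univ, Fintype.card_fin] at h2
  rw [← not_le, h1]
  omega

/-- The median deviates from `c` by more than `t` exactly when most entries deviate to the same
side. -/
lemma lt_abs_median_sub_iff (x : Fin (2 * m + 1) → ℝ) (c : ℝ) {t : ℝ} :
    t < |median (fun l => c + x l) - c| ↔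
      m < (Finset.univ.filter fun l => t < x l).card ∨
      m < (Finset.univ.filter fun l => t < -x l).card := by
  rw [lt_abs, lt_sub_iff_add_lt, neg_sub, lt_sub_comm, lt_median_iff, median_lt_iff]
  have h1 : ∀ l, t + c < c + x l ↔ t < x l := fun l => by
    constructor <;> intro h <;> linarith
  have h2 : ∀ l, c + x l < c - t ↔ t < -x l := fun l => by
    constructor <;> intro h <;> linarith
  simp only [h1, h2]

end Median

/-! ### Medians of independent copies of a symmetric variable -/

section Deviation

variable {α : Type*} [Fintype α] {m : ℕ}

/-- A Chernoff bound for the probability that most of `2 m + 1` independent events occur. -/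
lemma prob_majority_le [Nonempty α] (P : α → Prop) [DecidablePred P] {p : ℝ} (hp : prob P = p)
    (hp2 : p ≤ 1 / 2) :
    prob (fun ρ : Fin (2 * m + 1) → α => m < (Finset.univ.filter fun l => P (ρ l)).card) ≤
      2 ^ (2 * m + 1) * p ^ (m + 1) * (1 - p) ^ m := by
  classical
  have hp0 : 0 ≤ p := hp ▸ prob_nonneg P
  -- The main argument cancels $p^m$, so $p=0$ is separate: the event then never occurs.
  rcases hp0.eq_or_lt with h0 | hpos
  · subst h0
    have hn : ∀ a, ¬ P a := by
      intro a ha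
      have h1 : 𝔼 a, (if P a then (1 : ℝ) else 0) = 0 := by
        rw [← hp, prob]
        congr!
      rw [Fintype.expect_eq_zero_iff_of_nonneg
        (fun a => by dsimp only; split_ifs <;> simp)] at h1
      have := congrFun h1 a
      simp [ha] at this
    simp [hn, prob]
  -- Exponential tilting: weigh each occurrence by $1-p$ and each failure by $p$. Since $p\le 1-p$,
  -- the product is at least $(1-p)^{m+1}p^m$ whenever a majority occurs.
  · have hE : 𝔼 a, (if P a then 1 - p else p) = 2 * p * (1 - p) := by
      have h1 : ∀ a, (if P a then 1 - p else p) = p + (1 - 2 * p) * if P a then 1 else 0 := by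
        intro a; split_ifs <;> ring
      simp only [h1]
      rw [Finset.expect_add_distrib, Fintype.expect_const, ← Finset.mul_expect]
      have h2 : 𝔼 a, (if P a then (1 : ℝ) else 0) = p := by
        rw [← hp, prob]
        congr!
      rw [h2]; ring
    have hprod := expect_pi_prod (ι := Fin (2 * m + 1)) (α := α) (𝕜 := ℝ)
      (fun _ a => if P a then 1 - p else p)
    rw [hE, Finset.prod_const, Finset.card_univ, Fintype.card_fin] at hprod
    have hle : (1 - p) ^ (m + 1) * p ^ m * prob (fun ρ : Fin (2 * m + 1) → α =>
        m < (Finset.univ.filter fun l => P (ρ l)).card) ≤ (2 * p * (1 - p)) ^ (2 * m + 1) := by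
      rw [← hprod, prob, Finset.mul_expect]
      refine Finset.expect_le_expect fun ρ _ => ?_
      rw [Finset.prod_ite, Finset.prod_const, Finset.prod_const]
      split_ifs with h
      · have h2 := Finset.card_filter_add_card_filter_not
          (s := (Finset.univ : Finset (Fin (2 * m + 1)))) (fun l => P (ρ l))
        rw [Finset.card_univ, Fintype.card_fin] at h2
        obtain ⟨d, hd⟩ := Nat.exists_eq_add_of_lt h
        have h3 : m = (Finset.univ.filter fun l => ¬ P (ρ l)).card + d := by omega
        rw [mul_one]
        nth_rewrite 2 [h3]
        rw [show (Finset.univ.filter fun l => P (ρ l)).card = m + 1 + d by omega, pow_add, pow_add (1 - p) (m + 1)]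
        have h4 : p ^ d ≤ (1 - p) ^ d := pow_le_pow_left₀ hp0 (by linarith) d
        have h5 : 0 ≤ 1 - p := by linarith
        calc _ = (1 - p) ^ (m + 1) * p ^ (Finset.univ.filter fun l => ¬ P (ρ l)).card * p ^ d := by ring
          _ ≤ (1 - p) ^ (m + 1) * p ^ (Finset.univ.filter fun l => ¬ P (ρ l)).card * (1 - p) ^ d := by
            gcongr
          _ = _ := by ring
      · rw [mul_zero]
        have h5 : 0 ≤ 1 - p := by linarith
        positivity
    have h5 : 0 < 1 - p := by linarith
    have h6 : 0 < (1 - p) ^ (m + 1) * p ^ m := by positivity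
    refine le_of_mul_le_mul_left (hle.trans (le_of_eq ?_)) h6
    rw [mul_pow, mul_pow]
    ring

lemma prob_lt_neg_of_symm (X : α → ℝ) (σ : α ≃ α) (hσ : ∀ a, X (σ a) = - X a) (t : ℝ) : prob (fun a => t < -X a) = prob (fun a => t < X a) := by
  rw [← prob_comp_equiv σ (fun a => t < X a)]
  simp only [hσ]

lemma prob_lt_of_symm (X : α → ℝ) (σ : α ≃ α) (hσ : ∀ a, X (σ a) = - X a) {t : ℝ} (ht : 0 ≤ t) :
    prob (fun a => t < X a) = prob (fun a => t < |X a|) / 2 := by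
  have h : prob (fun a => t < |X a|) = prob (fun a => t < X a) + prob (fun a => t < -X a) := by
    unfold prob
    rw [← Finset.expect_add_distrib]
    refine Finset.expect_congr rfl fun a _ => ?_
    simp only [lt_abs]
    by_cases h1 : t < X a
    · simp [h1, show ¬ t < -X a by linarith]
    · by_cases h2 : t < -X a <;> simp [h1, h2]
  rw [h, prob_lt_neg_of_symm X σ hσ]; ring

/-- The tail of the median of `2 m + 1` independent copies of a symmetric variable. -/
lemma prob_lt_abs_median_le [Nonempty α] (X : α → ℝ) (σ : α ≃ α) (hσ : ∀ a, X (σ a) = - X a)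
    (c : ℝ) {t : ℝ} (ht : 0 ≤ t) :
    prob (fun ρ : Fin (2 * m + 1) → α => t < |median (fun l => c + X (ρ l)) - c|) ≤
      2 * prob (fun a => t < |X a|) * (1 - prob (fun a => |X a| ≤ t) ^ 2) ^ m := by
  set q := prob (fun a => t < |X a|) with hq
  have hr : prob (fun a => |X a| ≤ t) = 1 - q := by
    rw [hq, ← prob_not]; simp only [not_lt]
  have hq1 : q ≤ 1 := prob_le_one _
  have hp1 : prob (fun a => t < X a) = q / 2 := prob_lt_of_symm X σ hσ ht
  have hp2 : prob (fun a => t < -X a) = q / 2 := by rw [prob_lt_neg_of_symm X σ hσ, hp1]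
  simp only [lt_abs_median_sub_iff (m := m)]
  refine (prob_or_le _ _).trans ?_
  have h1 := prob_majority_le (m := m) (fun a => t < X a) hp1 (by linarith)
  have h2 := prob_majority_le (m := m) (fun a => t < -X a) hp2 (by linarith)
  refine (add_le_add h1 h2).trans (le_of_eq ?_)
  rw [hr, show 1 - (1 - q) ^ 2 = 2 ^ 2 * (q / 2) * (1 - q / 2) by ring, mul_pow, mul_pow, ← pow_mul]
  ring

/-- If all entries deviate, so does the median. -/
lemma le_prob_lt_abs_median (X : α → ℝ) (σ : α ≃ α) (hσ : ∀ a, X (σ a) = - X a)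
    (c : ℝ) {t : ℝ} (ht : 0 ≤ t) :
    (prob (fun a => t < |X a|) / 2) ^ (2 * m + 1) ≤
      prob (fun ρ : Fin (2 * m + 1) → α => t < |median (fun l => c + X (ρ l)) - c|) := by
  classical
  have hprod := expect_pi_prod (ι := Fin (2 * m + 1)) (α := α) (𝕜 := ℝ)
      (fun _ a => if t < X a then 1 else 0)
  have h1 : 𝔼 a, (if t < X a then (1 : ℝ) else 0) = prob (fun a => t < |X a|) / 2 := by
    rw [← prob_lt_of_symm X σ hσ ht, prob]
  rw [h1, Finset.prod_const, Finset.card_univ, Fintype.card_fin] at hprod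
  rw [← hprod, prob]
  refine Finset.expect_le_expect fun ρ _ => ?_
  by_cases h : ∀ l, t < X (ρ l)
  · have h2 : t < |median (fun l => c + X (ρ l)) - c| := by
      rw [lt_abs_median_sub_iff, Finset.filter_true_of_mem fun l _ => h l, Finset.card_univ,
        Fintype.card_fin]
      left
      omega
    simp [h, h2]
  · push Not at h
    obtain ⟨l, hl⟩ := h
    rw [Finset.prod_eq_zero (Finset.mem_univ l) (if_neg hl.not_gt)]
    split_ifs <;> norm_num

open Complex in
/-- The characteristic function of a sum of independent symmetric variables. -/
lemma expect_cos_sum {ι : Type*} [Fintype ι] [DecidableEq ι] (Y : ι → α → ℝ) (σ : α ≃ α)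
    (hσ : ∀ l a, Y l (σ a) = -Y l a) :
    𝔼 ρ : ι → α, Real.cos (∑ l, Y l (ρ l)) = ∏ l, 𝔼 a, Real.cos (Y l a) := by
  -- Symmetry makes each complex characteristic function real, so the product formula can be read
  -- off from real parts.
  have hsin : ∀ l, 𝔼 a, Real.sin (Y l a) = 0 := by
    intro l
    have h : 𝔼 a, Real.sin (Y l a) = 𝔼 a, -Real.sin (Y l a) :=
      (Fintype.expect_equiv σ _ _ fun a => by rw [hσ, Real.sin_neg, neg_neg]).trans rfl
    rw [Finset.expect_neg_distrib] at h
    linarith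
  have h1 : ∀ l, 𝔼 a, exp (Y l a * I) = ((𝔼 a, Real.cos (Y l a) : ℝ) : ℂ) := by
    intro l
    have h2 : ∀ a, exp (Y l a * I) = (Real.cos (Y l a) : ℂ) + (Real.sin (Y l a) : ℂ) * I := by
      intro a
      rw [exp_mul_I, ofReal_cos, ofReal_sin]
    simp only [h2]
    rw [Finset.expect_add_distrib, ← Finset.expect_mul, ← ofReal_expect, ← ofReal_expect, hsin]
    simp
  have h3 := expect_pi_prod (𝕜 := ℂ) (fun l a => exp (Y l a * I))
  simp only [h1] at h3
  rw [← ofReal_prod] at h3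
  have h4 : ∀ ρ : ι → α, ∏ l, exp (Y l (ρ l) * I) =
      (Real.cos (∑ l, Y l (ρ l)) : ℂ) + (Real.sin (∑ l, Y l (ρ l)) : ℂ) * I := by
    intro ρ
    rw [← exp_sum, ← Finset.sum_mul, ← ofReal_sum, exp_mul_I, ofReal_cos, ofReal_sin]
  simp only [h4] at h3
  rw [Finset.expect_add_distrib, ← Finset.expect_mul, ← ofReal_expect, ← ofReal_expect] at h3
  have h5 := congrArg re h3
  simp only [add_re, ofReal_re, mul_re, I_re, I_im, ofReal_im, mul_zero, zero_mul, sub_zero,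
    add_zero] at h5
  exact h5

/-- A lower tail bound for the median of independent copies of a symmetric variable: the signs of
the large entries form a random walk that has to outweigh the number of small entries. -/
lemma le_prob_lt_abs_median_of_cos [Nonempty α] (X : α → ℝ) (σ : α ≃ α)
    (hσ : ∀ a, X (σ a) = - X a) (c : ℝ) {t θ : ℝ} (ht : 0 ≤ t) (hθ : 0 ≤ θ) :
    (1 - (1 - prob (fun a => t < |X a|) * (1 - Real.cos θ)) ^ (2 * m + 1)) / 2 -
        θ / 2 * ((2 * m + 1) * prob (fun a => |X a| ≤ t)) ≤
      prob (fun ρ : Fin (2 * m + 1) → α => t < |median (fun l => c + X (ρ l)) - c|) := by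
  classical
  -- The sign of a large entry, and $0$ for a small one.
  set Y : α → ℝ := fun a => if t < X a then 1 else if t < -X a then -1 else 0 with hY
  have hYσ : ∀ a, Y (σ a) = -Y a := by
    intro a
    simp only [hY, hσ, neg_neg]
    split_ifs <;> first | (norm_num; done) | (exfalso; linarith)
  have h1 := expect_cos_sum (ι := Fin (2 * m + 1)) (fun _ a => θ * Y a) σ
    (fun _ a => by rw [hYσ]; ring)
  have h2 : 𝔼 a, Real.cos (θ * Y a) = 1 - prob (fun a => t < |X a|) * (1 - Real.cos θ) := by
    rw [prob, Finset.expect_mul, eq_sub_iff_add_eq, ← Finset.expect_add_distrib]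
    conv_rhs => rw [← Fintype.expect_const (ι := α) (1 : ℝ)]
    refine Finset.expect_congr rfl fun a _ => ?_
    simp only [hY, lt_abs]
    by_cases h1 : t < X a
    · simp [h1]
    · by_cases h2 : t < -X a <;> simp [h1, h2]
  rw [h2, Finset.prod_const, Finset.card_univ, Fintype.card_fin] at h1
  simp only [← Finset.mul_sum] at h1
  have h3 : 𝔼 ρ : Fin (2 * m + 1) → α, ∑ l, (if |X (ρ l)| ≤ t then (1 : ℝ) else 0) =
      (2 * m + 1) * prob (fun a => |X a| ≤ t) := by
    rw [Finset.expect_sum_comm]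
    have h4 : ∀ l : Fin (2 * m + 1), 𝔼 ρ : Fin (2 * m + 1) → α,
        (if |X (ρ l)| ≤ t then (1 : ℝ) else 0) = prob (fun a => |X a| ≤ t) := by
      intro l
      have := expect_pi_prod (ι := Fin (2 * m + 1)) (α := α) (𝕜 := ℝ)
        (fun l' a => if l' = l then (if |X a| ≤ t then 1 else 0) else 1)
      simp only [Finset.prod_ite_eq', Finset.mem_univ, if_true] at this
      rw [this, Finset.prod_eq_single l]
      · simp only [if_true, prob]
      · intro b _ hb
        simp [hb]
      · simp
    simp only [h4]
    simp
  have h5 : 1 - 𝔼 ρ : Fin (2 * m + 1) → α, Real.cos (θ * ∑ l, Y (ρ l)) =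
      𝔼 ρ : Fin (2 * m + 1) → α, (1 - Real.cos (θ * ∑ l, Y (ρ l))) := by
    rw [Finset.expect_sub_distrib, Fintype.expect_const]
  -- The inequality holds pointwise. If the median does not deviate, neither sign occurs more than
  -- $m$ times, so $|S|\le R$ and $1-\cos(\theta S)\le\theta|S|\le\theta R$.
  rw [← h1, ← h3, h5, prob, Finset.mul_expect, Finset.expect_div, ← Finset.expect_sub_distrib]
  refine Finset.expect_le_expect fun ρ _ => ?_
  set S := ∑ l, Y (ρ l) with hS
  set R := ∑ l, (if |X (ρ l)| ≤ t then (1 : ℝ) else 0) with hR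
  have hR0 : 0 ≤ R := Finset.sum_nonneg fun l _ => by split_ifs <;> norm_num
  split_ifs with h
  · have := Real.neg_one_le_cos (θ * S)
    have : 0 ≤ θ / 2 * R := by positivity
    linarith
  · rw [lt_abs_median_sub_iff, not_or, not_lt, not_lt] at h
    set p := (Finset.univ.filter fun l => t < X (ρ l)).card with hp
    set n := (Finset.univ.filter fun l => t < -X (ρ l)).card with hn
    have hSpn : S = p - n := by
      rw [hS, hp, hn, Finset.card_filter, Finset.card_filter, Nat.cast_sum, Nat.cast_sum,
        ← Finset.sum_sub_distrib]
      refine Finset.sum_congr rfl fun l _ => ?_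
      simp only [hY]
      by_cases h1 : t < X (ρ l)
      · simp [h1, show ¬ t < -X (ρ l) by linarith]
      · by_cases h2 : t < -X (ρ l) <;> simp [h1, h2]
    have hRpn : p + n + R = 2 * m + 1 := by
      rw [hR, hp, hn, Finset.card_filter, Finset.card_filter, Nat.cast_sum, Nat.cast_sum,
        ← Finset.sum_add_distrib, ← Finset.sum_add_distrib]
      rw [Finset.sum_congr rfl (g := fun _ => (1 : ℝ))]
      · simp
      refine fun l _ => ?_
      simp only [← not_lt, lt_abs]
      by_cases h1 : t < X (ρ l)
      · simp [h1, show ¬ t < -X (ρ l) by linarith]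
      · by_cases h2 : t < -X (ρ l) <;> simp [h1, h2]
    have hpm : (p : ℝ) ≤ m := by exact_mod_cast h.1
    have hnm : (n : ℝ) ≤ m := by exact_mod_cast h.2
    have hSR : |S| ≤ R := abs_le.2 ⟨by linarith, by linarith⟩
    have hcos : 1 - Real.cos (θ * S) ≤ |θ * S| := by
      have h5 := Real.one_sub_sq_div_two_le_cos (x := θ * S)
      have h6 := Real.neg_one_le_cos (θ * S)
      rw [← sq_abs] at h5
      rcases le_or_gt |θ * S| 2 with h7 | h7
      · nlinarith [abs_nonneg (θ * S)]
      · linarith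
    rw [abs_mul, abs_of_nonneg hθ] at hcos
    have := mul_le_mul_of_nonneg_left hSR hθ
    linarith

end Deviation
/-! ### The error of a single row -/

/-- The random choices of a single row. -/
abbrev RowSeed (n B : ℕ) : Type := (Fin n → Fin B) × (Fin n → ℤˣ)

/-- The error of the estimate of `f i` from a single row. -/
noncomputable def rowError {n B : ℕ} (f : Fin n → ℝ) (i : Fin n) (ρ : RowSeed n B) : ℝ :=
  (((ρ.2 i : ℤ)) : ℝ) *
    ∑ j ∈ Finset.univ.erase i, if ρ.1 j = ρ.1 i then (((ρ.2 j : ℤ)) : ℝ) * f j else 0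

section Row

variable {n B k : ℕ}

lemma intUnit_cast_mul_self (s : ℤˣ) : ((s : ℤ) : ℝ) * ((s : ℤ) : ℝ) = 1 := by
  rcases Int.units_eq_one_or s with rfl | rfl <;> simp

lemma estimate_eq_median (f : Fin n → ℝ) (ω : Seed n B k) (i : Fin n) :
    estimate f ω i = median (fun l => f i + rowError f i (ω.1 l, ω.2 l)) := by
  unfold estimate table rowError
  congr 1
  ext l
  rw [← Finset.add_sum_erase _ _ (Finset.mem_univ i), if_pos rfl, mul_add, ← mul_assoc,
    intUnit_cast_mul_self, one_mul]

lemma expect_seed_eq (F : (Fin k → RowSeed n B) → ℝ) :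
    𝔼 ω : Seed n B k, F (fun l => (ω.1 l, ω.2 l)) = 𝔼 ρ : Fin k → RowSeed n B, F ρ :=
  (Fintype.expect_equiv (Equiv.arrowProdEquivProdArrow (Fin k) (fun _ => Fin n → Fin B)
    (fun _ => Fin n → ℤˣ)) _ _ fun _ => rfl).symm

lemma expectedError_eq (i : Fin n) : expectedError n B k i =
    𝔼 ρ : Fin k → RowSeed n B,
      |median (fun l => zipf n i + rowError (zipf n) i (ρ l)) - zipf n i| := by
  rw [← expect_seed_eq]
  simp only [expectedError, estimate_eq_median]

/-- Negating the sign of `i` is a measure-preserving involution that negates the row error. -/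
def flipSign (i : Fin n) : RowSeed n B ≃ RowSeed n B where
  toFun ρ := (ρ.1, Function.update ρ.2 i (-ρ.2 i))
  invFun ρ := (ρ.1, Function.update ρ.2 i (-ρ.2 i))
  left_inv ρ := by simp
  right_inv ρ := by simp

lemma rowError_flipSign (f : Fin n → ℝ) (i : Fin n) (ρ : RowSeed n B) :
    rowError f i (flipSign i ρ) = -rowError f i ρ := by
  simp only [rowError, flipSign, Equiv.coe_fn_mk, Function.update_self, Units.val_neg,
    Int.cast_neg, neg_mul, neg_inj]
  congr 1
  refine Finset.sum_congr rfl fun j hj => ?_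
  simp only [Function.update_of_ne (Finset.ne_of_mem_erase hj)]

lemma expect_cos_signs (a : Fin n → ℝ) :
    𝔼 s : Fin n → ℤˣ, Real.cos (∑ j, ((s j : ℤ) : ℝ) * a j) = ∏ j, Real.cos (a j) := by
  rw [expect_cos_sum (fun j (s : ℤˣ) => ((s : ℤ) : ℝ) * a j) (Equiv.neg ℤˣ)
    (fun _ s => by simp)]
  refine Finset.prod_congr rfl fun j _ => ?_
  rw [← Fintype.expect_const (ι := ℤˣ) (Real.cos (a j))]
  refine Finset.expect_congr rfl fun s _ => ?_
  rcases Int.units_eq_one_or s with rfl | rfl <;> simp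

/-- The expectation over a random hash function of a product over the items other than `i` of
factors depending on whether the item collides with `i`. -/
lemma expect_hash_prod [NeZero B] (i : Fin n) (c : Fin n → ℝ) :
    𝔼 h : Fin n → Fin B, ∏ j ∈ Finset.univ.erase i, (if h j = h i then c j else 1) =
      ∏ j ∈ Finset.univ.erase i, (1 - (1 - c j) / B) := by
  have hB : (B : ℝ) ≠ 0 := Nat.cast_ne_zero.2 (NeZero.ne B)
  -- Summing over the value $b$ of $h(i)$ makes the factors depend on separate coordinates of $h$.
  have h1 : ∀ h : Fin n → Fin B, ∏ j ∈ Finset.univ.erase i, (if h j = h i then c j else 1) =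
      ∑ b : Fin B, ∏ j, (if j = i then (if h j = b then 1 else 0) else
        (if h j = b then c j else 1)) := by
    intro h
    rw [Finset.sum_eq_single (h i)]
    · rw [← Finset.mul_prod_erase _ _ (Finset.mem_univ i)]
      simp only [if_true, one_mul]
      exact Finset.prod_congr rfl fun j hj => by rw [if_neg (Finset.ne_of_mem_erase hj)]
    · intro b _ hb
      exact Finset.prod_eq_zero (Finset.mem_univ i) (by simp [hb.symm])
    · simp
  simp only [h1]
  rw [Finset.expect_sum_comm]
  have h2 : ∀ b : Fin B, 𝔼 h : Fin n → Fin B, ∏ j, (if j = i then (if h j = b then (1 : ℝ) else 0) else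
        (if h j = b then c j else 1)) = 1 / B * ∏ j ∈ Finset.univ.erase i, (1 - (1 - c j) / B) := by
    intro b
    rw [expect_pi_prod (fun j (x : Fin B) => if j = i then (if x = b then (1 : ℝ) else 0) else
        (if x = b then c j else 1)), ← Finset.mul_prod_erase _ _ (Finset.mem_univ i)]
    congr 1
    · simp
    · refine Finset.prod_congr rfl fun j hj => ?_
      simp only [if_neg (Finset.ne_of_mem_erase hj)]
      have h3 : ∀ x : Fin B, (if x = b then c j else 1) = 1 - if x = b then 1 - c j else 0 := by
        intro x; split_ifs <;> ring
      simp only [h3]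
      rw [Finset.expect_sub_distrib, Fintype.expect_const]
      rw [Fintype.expect_eq_sum_div_card, Finset.sum_ite_eq' Finset.univ b,
        if_pos (Finset.mem_univ b), Fintype.card_fin]
  simp only [h2]
  simp [hB]

/-- The characteristic function of the row error. -/
lemma expect_cos_rowError [NeZero B] (f : Fin n → ℝ) (i : Fin n) (u : ℝ) :
    𝔼 ρ : RowSeed n B, Real.cos (u * rowError f i ρ) =
      ∏ j ∈ Finset.univ.erase i, (1 - (1 - Real.cos (u * f j)) / B) := by
  rw [← expect_hash_prod, ← Finset.univ_product_univ, Finset.expect_product]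
  refine Finset.expect_congr rfl fun h _ => ?_
  have h1 : ∀ s : Fin n → ℤˣ, Real.cos (u * rowError f i (h, s)) =
      Real.cos (∑ j, ((s j : ℤ) : ℝ) * (if j = i then 0 else if h j = h i then u * f j else 0)) := by
    intro s
    have h2 : u * ∑ j ∈ Finset.univ.erase i, (if h j = h i then ((s j : ℤ) : ℝ) * f j else 0) =
        ∑ j, ((s j : ℤ) : ℝ) * (if j = i then 0 else if h j = h i then u * f j else 0) := by
      rw [← Finset.add_sum_erase _ _ (Finset.mem_univ i), Finset.mul_sum]
      simp only [if_true, mul_zero, zero_add]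
      refine Finset.sum_congr rfl fun j hj => ?_
      rw [if_neg (Finset.ne_of_mem_erase hj)]
      split_ifs <;> ring
    rw [← h2]
    unfold rowError
    -- The sign of $i$ is a global factor $\pm1$, invisible to the even function $\cos$.
    rcases Int.units_eq_one_or (s i) with hs | hs
    · simp [hs]
    · simp only [hs]
      rw [← Real.cos_neg]
      congr 1
      push_cast
      ring
  simp only [h1]
  rw [expect_cos_signs, ← Finset.mul_prod_erase _ _ (Finset.mem_univ i)]
  simp only [if_true, Real.cos_zero, one_mul]
  refine Finset.prod_congr rfl fun j hj => ?_
  rw [if_neg (Finset.ne_of_mem_erase hj)]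
  split_ifs <;> simp

/-! ### Bounds on the characteristic function for Zipfian frequencies -/

/-- Merges the quadratic bound near $0$ with the trivial bound $2$. At $y=u/j$ it becomes
$8u^2/(u+j)^2$, whose sum over $j$ is controlled by a telescoping one. -/
lemma one_sub_cos_le_div (y : ℝ) : 1 - Real.cos y ≤ 8 * y ^ 2 / (1 + |y|) ^ 2 := by
  rw [le_div_iff₀ (by positivity), ← sq_abs y]
  have h1 := Real.one_sub_sq_div_two_le_cos (x := y)
  have h2 := Real.neg_one_le_cos y
  have h3 := Real.cos_le_one y
  rw [← sq_abs] at h1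
  have h0 := abs_nonneg y
  rcases le_or_gt |y| 1 with h | h
  · calc (1 - Real.cos y) * (1 + |y|) ^ 2 ≤ (|y| ^ 2 / 2) * 2 ^ 2 := by
          gcongr <;> linarith
      _ ≤ 8 * |y| ^ 2 := by nlinarith
  · calc (1 - Real.cos y) * (1 + |y|) ^ 2 ≤ 2 * (2 * |y|) ^ 2 := by
          gcongr <;> linarith
      _ ≤ 8 * |y| ^ 2 := by nlinarith

lemma sum_one_sub_cos_le (n : ℕ) {u : ℝ} (hu : 0 ≤ u) :
    ∑ j : Fin n, (1 - Real.cos (u * zipf n j)) ≤ 8 * u := by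
  rcases hu.eq_or_lt with rfl | hu
  · simp
  have h1 : ∀ N : ℕ, ∑ j ∈ Finset.range N, (1 - Real.cos (u * (1 / ((j : ℝ) + 1)))) ≤
      8 * u - 8 * u ^ 2 / (u + N) := by
    intro N
    induction N with
    | zero => simp; field_simp; simp
    | succ N ih =>
      rw [Finset.sum_range_succ]
      have h2 := one_sub_cos_le_div (u * (1 / ((N : ℝ) + 1)))
      rw [abs_of_pos (by positivity)] at h2
      have h3 : 8 * (u * (1 / ((N : ℝ) + 1))) ^ 2 / (1 + u * (1 / ((N : ℝ) + 1))) ^ 2 =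
          8 * u ^ 2 / (u + N + 1) ^ 2 := by
        field_simp
        ring
      have h4 : 8 * u ^ 2 / (u + N) - 8 * u ^ 2 / (u + (N + 1)) =
          8 * u ^ 2 / ((u + N) * (u + N + 1)) := by
        field_simp
        ring
      have h5 : 8 * u ^ 2 / (u + N + 1) ^ 2 ≤ 8 * u ^ 2 / ((u + N) * (u + N + 1)) := by
        gcongr
        nlinarith [(Nat.cast_nonneg N : (0 : ℝ) ≤ N)]
      push_cast
      linarith
  have h2 := h1 n
  rw [← Fin.sum_univ_eq_sum_range (fun j : ℕ => 1 - Real.cos (u * (1 / ((j : ℝ) + 1))))] at h2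
  have h3 : 0 ≤ 8 * u ^ 2 / (u + n) := by positivity
  simp only [zipf]
  linarith

/-- Ranks $j$ in $[u/3,u]$ have $u/j\in[1,3]$, where $1-\cos$ is at least $2/\pi^2\ge1/5$. There are
at least $2u/3-1$ of them, and dropping $i$ costs at most one; $u\ge6$ absorbs both losses. -/
lemma le_sum_one_sub_cos {n : ℕ} (i : Fin n) {u : ℝ} (hu : 6 ≤ u) (hun : u ≤ n) :
    u / 15 ≤ ∑ j ∈ Finset.univ.erase i, (1 - Real.cos (u * zipf n j)) := by
  classical
  set a := ⌈u / 3⌉₊ with ha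
  set b := ⌊u⌋₊ with hb
  have ha1 : (a : ℝ) < u / 3 + 1 := Nat.ceil_lt_add_one (by linarith)
  have hb1 : u < b + 1 := Nat.lt_floor_add_one u
  have ha0 : u / 3 ≤ a := Nat.le_ceil _
  have hb0 : (b : ℝ) ≤ u := Nat.floor_le (by linarith)
  have hbn : b ≤ n := by exact_mod_cast hb0.trans hun
  have hterm : ∀ j : Fin n, (if a ≤ (j : ℕ) + 1 ∧ (j : ℕ) + 1 ≤ b then (1 / 5 : ℝ) else 0) ≤
      1 - Real.cos (u * zipf n j) := by
    intro j
    split_ifs with h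
    · have h1 : (a : ℝ) ≤ j + 1 := by exact_mod_cast h.1
      have h2 : (j : ℝ) + 1 ≤ b := by exact_mod_cast h.2
      have hj : (0 : ℝ) < j + 1 := by positivity
      have hy1 : 1 ≤ u * zipf n j := by
        rw [zipf, mul_one_div, le_div_iff₀ hj]; linarith
      have hy3 : u * zipf n j ≤ 3 := by
        rw [zipf, mul_one_div, div_le_iff₀ hj]; linarith
      have h3 := Real.cos_le_one_sub_mul_cos_sq (x := u * zipf n j)
        (by rw [abs_of_nonneg (by linarith)]; linarith [Real.pi_gt_three])
      have h4 : 1 / 5 ≤ 2 / Real.pi ^ 2 := by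
        rw [div_le_div_iff₀ (by norm_num) (by positivity)]
        nlinarith [Real.pi_lt_d2, Real.pi_pos]
      nlinarith
    · linarith [Real.cos_le_one (u * zipf n j)]
  have hcard : (b : ℝ) - a + 1 ≤
      5 * ∑ j : Fin n, (if a ≤ (j : ℕ) + 1 ∧ (j : ℕ) + 1 ≤ b then (1 / 5 : ℝ) else 0) := by
    rw [Fin.sum_univ_eq_sum_range
      (fun j : ℕ => if a ≤ j + 1 ∧ j + 1 ≤ b then (1 / 5 : ℝ) else 0) n, ← Finset.sum_filter,
      Finset.sum_const, nsmul_eq_mul]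
    have hsub : Finset.Ico (a - 1) b ⊆
        (Finset.range n).filter (fun j => a ≤ j + 1 ∧ j + 1 ≤ b) := by
      intro j hj
      rw [Finset.mem_Ico] at hj
      rw [Finset.mem_filter, Finset.mem_range]
      omega
    have hle := Finset.card_le_card hsub
    rw [Nat.card_Ico] at hle
    have ha2 : 1 ≤ a := Nat.ceil_pos.2 (by linarith)
    have : b + 1 ≤ ((Finset.range n).filter (fun j => a ≤ j + 1 ∧ j + 1 ≤ b)).card + a := by omega
    have : (b : ℝ) + 1 ≤ ((Finset.range n).filter (fun j => a ≤ j + 1 ∧ j + 1 ≤ b)).card + a := by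
      exact_mod_cast this
    linarith
  have hi : (if a ≤ (i : ℕ) + 1 ∧ (i : ℕ) + 1 ≤ b then (1 / 5 : ℝ) else 0) ≤ 1 / 5 := by
    split_ifs <;> norm_num
  have hsum := Finset.sum_le_sum fun j (_ : j ∈ Finset.univ.erase i) => hterm j
  rw [← Finset.add_sum_erase _ _ (Finset.mem_univ i)] at hcard
  linarith

/-- The characteristic function of the row error for Zipfian frequencies. -/
noncomputable def zipfCharFun (B : ℕ) {n : ℕ} (i : Fin n) (u : ℝ) : ℝ :=
  ∏ j ∈ Finset.univ.erase i, (1 - (1 - Real.cos (u * zipf n j)) / B)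

/-- Since $1-\cos y$ can reach $2$, two buckets are what keeps every factor, hence the
characteristic function, nonnegative. -/
lemma zipf_factor_nonneg (hB : 2 ≤ B) (y : ℝ) : 0 ≤ 1 - (1 - Real.cos y) / B := by
  have hB' : (2 : ℝ) ≤ B := by exact_mod_cast hB
  rw [sub_nonneg, div_le_one (by linarith)]
  linarith [Real.neg_one_le_cos y]

lemma zipf_factor_le_one (y : ℝ) : 1 - (1 - Real.cos y) / B ≤ 1 := by
  have : 0 ≤ (1 - Real.cos y) / B := div_nonneg (by linarith [Real.cos_le_one y]) (by positivity)
  linarith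

lemma zipfCharFun_nonneg (hB : 2 ≤ B) (i : Fin n) (u : ℝ) : 0 ≤ zipfCharFun B i u :=
  Finset.prod_nonneg fun _ _ => zipf_factor_nonneg hB _

lemma zipfCharFun_le_one (hB : 2 ≤ B) (i : Fin n) (u : ℝ) : zipfCharFun B i u ≤ 1 :=
  Finset.prod_le_one (fun _ _ => zipf_factor_nonneg hB _) fun _ _ => zipf_factor_le_one _

lemma one_sub_zipfCharFun_le (hB : 2 ≤ B) (i : Fin n) {u : ℝ} (hu : 0 ≤ u) :
    1 - zipfCharFun B i u ≤ 8 / B * u := by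
  have hB' : (2 : ℝ) ≤ B := by exact_mod_cast hB
  -- The Weierstrass product inequality $\prod(1-a_j)\ge1-\sum a_j$ for $a_j\in[0,1]$.
  have key : ∀ s : Finset (Fin n), 1 - ∑ j ∈ s, (1 - Real.cos (u * zipf n j)) / B ≤
      ∏ j ∈ s, (1 - (1 - Real.cos (u * zipf n j)) / B) := by
    intro s
    induction s using Finset.induction_on with
    | empty => simp
    | insert j s hj ih =>
      rw [Finset.sum_insert hj, Finset.prod_insert hj]
      have h1 := zipf_factor_le_one (B := B) (u * zipf n j)
      have h2 := zipf_factor_nonneg hB (u * zipf n j)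
      have h3 : ∏ j ∈ s, (1 - (1 - Real.cos (u * zipf n j)) / B) ≤ 1 :=
        Finset.prod_le_one (fun _ _ => zipf_factor_nonneg hB _) fun _ _ => zipf_factor_le_one _
      nlinarith
  have h1 := key (Finset.univ.erase i)
  rw [← Finset.sum_div] at h1
  have h2 : ∑ j ∈ Finset.univ.erase i, (1 - Real.cos (u * zipf n j)) ≤ 8 * u :=
    (Finset.sum_le_sum_of_subset_of_nonneg (Finset.erase_subset _ _)
      fun j _ _ => by linarith [Real.cos_le_one (u * zipf n j)]).trans (sum_one_sub_cos_le n hu)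
  have h3 : (∑ j ∈ Finset.univ.erase i, (1 - Real.cos (u * zipf n j))) / B ≤ 8 * u / B := by gcongr
  have h4 : 8 / B * u = 8 * u / B := by ring
  unfold zipfCharFun
  linarith

lemma zipfCharFun_le_exp (hB : 2 ≤ B) (i : Fin n) {u : ℝ} (hu : 6 ≤ u) (hun : u ≤ n) :
    zipfCharFun B i u ≤ Real.exp (-(1 / (15 * B)) * u) := by
  have hB' : (2 : ℝ) ≤ B := by exact_mod_cast hB
  calc zipfCharFun B i u ≤
        ∏ j ∈ Finset.univ.erase i, Real.exp (-((1 - Real.cos (u * zipf n j)) / B)) :=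
        Finset.prod_le_prod (fun _ _ => zipf_factor_nonneg hB _)
          fun j _ => by linarith [Real.add_one_le_exp (-((1 - Real.cos (u * zipf n j)) / B))]
    _ ≤ _ := by
      rw [← Real.exp_sum, Finset.sum_neg_distrib, ← Finset.sum_div, Real.exp_le_exp]
      have h1 := le_sum_one_sub_cos i hu hun
      have h2 : u / 15 / B ≤ (∑ j ∈ Finset.univ.erase i, (1 - Real.cos (u * zipf n j))) / B := by
        gcongr
      have h3 : -(1 / (15 * (B : ℝ))) * u = -(u / 15 / B) := by field_simp
      linarith

/-- The factor $2$ covers $u\le6$, where the exponent is at least $-1/5$. -/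
lemma zipfCharFun_le_two_mul_exp (hB : 2 ≤ B) (i : Fin n) {u : ℝ} (hu : 0 ≤ u) (hun : u ≤ n) :
    zipfCharFun B i u ≤ 2 * Real.exp (-(1 / (15 * B)) * u) := by
  have hB' : (2 : ℝ) ≤ B := by exact_mod_cast hB
  rcases le_or_gt 6 u with h | h
  · linarith [zipfCharFun_le_exp hB i h hun, Real.exp_pos (-(1 / (15 * (B : ℝ))) * u)]
  · have h1 : 1 / (15 * (B : ℝ)) * u ≤ 1 / (15 * 2) * 6 := by gcongr
    linarith [zipfCharFun_le_one hB i u, Real.add_one_le_exp (-(1 / (15 * (B : ℝ))) * u)]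

end Row
-- Row error probabilities and the expected error of the median
section Bounds

variable {n B m : ℕ}

lemma prob_lt_abs_rowError_le [NeZero B] (hB : 2 ≤ B) (i : Fin n) {t : ℝ} (ht : 0 < t) :
    prob (fun ρ : RowSeed n B => t < |rowError (zipf n) i ρ|) ≤ 48 / (t * B) := by
  have hB' : (2 : ℝ) ≤ B := by exact_mod_cast hB
  refine (prob_lt_abs_le (L := 8 / B) _ ht (by positivity) fun u hu => ?_).trans (le_of_eq ?_)
  · rw [expect_cos_rowError]
    exact one_sub_zipfCharFun_le hB i hu
  · field_simp
    norm_num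

lemma le_prob_abs_rowError_le [NeZero B] (hB : 2 ≤ B) (i : Fin n) {t : ℝ} (ht : 0 < t) :
    min (t * B / 32) 1 / 40 ≤ prob (fun ρ : RowSeed n B => |rowError (zipf n) i ρ| ≤ t) := by
  have hB' : (2 : ℝ) ≤ B := by exact_mod_cast hB
  have h := le_prob_abs_le (fun ρ : RowSeed n B => rowError (zipf n) i ρ) (half_pos ht)
    (L := 8 / B) (by positivity)
    (fun u => by rw [expect_cos_rowError]; exact zipfCharFun_nonneg hB i u)
    (fun u hu => by rw [expect_cos_rowError]; exact one_sub_zipfCharFun_le hB i hu)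
  rw [mul_div_cancel₀ t two_ne_zero] at h
  convert h using 3
  field_simp
  norm_num

lemma prob_abs_rowError_le [NeZero B] (hB : 2 ≤ B) (i : Fin n) {t : ℝ} (ht : 0 < t)
    (htn : 1 / t ≤ n) :
    prob (fun ρ : RowSeed n B => |rowError (zipf n) i ρ| ≤ t) ≤ 120 * (t * B) := by
  have hB' : (2 : ℝ) ≤ B := by exact_mod_cast hB
  refine (prob_abs_le_le (κ := 1 / (15 * B)) _ ht (by positivity) fun u hu hut => ?_).trans
    (le_of_eq ?_)
  · rw [expect_cos_rowError]
    exact zipfCharFun_le_two_mul_exp hB i hu (hut.trans htn)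
  · field_simp
    norm_num

/-- With constant probability a row error is of order at least `1 / B`. -/
lemma le_prob_lt_abs_rowError [NeZero B] (hB : 3 ≤ B) (hn : 2 * B ≤ n) (i : Fin n) :
    1 / 34 ≤ prob (fun ρ : RowSeed n B => 1 / (6 * B) < |rowError (zipf n) i ρ|) := by
  have hB' : (3 : ℝ) ≤ B := by exact_mod_cast hB
  have hn' : 2 * (B : ℝ) ≤ n := by exact_mod_cast hn
  -- At $u=2B$ the characteristic function is at most $15/17$, while rows with error at most
  -- $1/(6B)$ contribute at most $1/18$ to $1-\varphi(u)$; so large errors must supply the rest.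
  have h1 := zipfCharFun_le_exp (B := B) (by omega) i (u := 2 * B) (by linarith) hn'
  rw [show -(1 / (15 * (B : ℝ))) * (2 * B) = -(2 / 15) by field_simp, Real.exp_neg] at h1
  have h2 : (Real.exp (2 / 15))⁻¹ ≤ 15 / 17 := by
    rw [inv_le_comm₀ (Real.exp_pos _) (by norm_num)]
    linarith [Real.add_one_le_exp (2 / 15 : ℝ)]
  have h3 : 1 - 𝔼 ρ : RowSeed n B, Real.cos (2 * B * rowError (zipf n) i ρ) ≤
      1 / 18 + 2 * prob (fun ρ : RowSeed n B => 1 / (6 * B) < |rowError (zipf n) i ρ|) := by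
    have h4 : 1 - 𝔼 ρ : RowSeed n B, Real.cos (2 * B * rowError (zipf n) i ρ) =
        𝔼 ρ : RowSeed n B, (1 - Real.cos (2 * B * rowError (zipf n) i ρ)) := by
      rw [Finset.expect_sub_distrib, Fintype.expect_const]
    rw [h4, ← sub_le_iff_le_add', ← Fintype.expect_const (ι := RowSeed n B) (1 / 18 : ℝ), prob,
      ← Finset.expect_sub_distrib, Finset.mul_expect]
    refine Finset.expect_le_expect fun ρ _ => ?_
    split_ifs with h
    · linarith [Real.neg_one_le_cos (2 * B * rowError (zipf n) i ρ)]
    · have h4 := Real.one_sub_sq_div_two_le_cos (x := 2 * B * rowError (zipf n) i ρ)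
      have h5 : |2 * B * rowError (zipf n) i ρ| ≤ 1 / 3 := by
        rw [not_lt, le_div_iff₀ (by positivity)] at h
        rw [abs_mul, abs_of_pos (by positivity : (0 : ℝ) < 2 * B)]
        linarith
      rw [← sq_abs] at h4
      nlinarith [abs_nonneg (2 * B * rowError (zipf n) i ρ)]
  rw [expect_cos_rowError] at h3
  unfold zipfCharFun at h1
  linarith

/-- Bernoulli's inequality and $(1-y)(1+y)\le1$. With $y=r^2$ this extracts the factor $1/k$ from
the Chernoff bound. -/
lemma one_sub_pow_mul_le {y : ℝ} (h0 : 0 ≤ y) (h1 : y ≤ 1) (m : ℕ) :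
    (1 - y) ^ m * (1 + m * y) ≤ 1 :=
  calc (1 - y) ^ m * (1 + m * y) ≤ (1 - y) ^ m * (1 + y) ^ m := by
        have : 0 ≤ 1 - y := by linarith
        gcongr
        exact one_add_mul_le_pow (by linarith) m
    _ = ((1 - y) * (1 + y)) ^ m := (mul_pow _ _ _).symm
    _ ≤ 1 := pow_le_one₀ (by nlinarith) (by nlinarith)

lemma expectedError_le [NeZero B] (hB : 2 ≤ B) (hm : 1 ≤ m) (i : Fin n) :
    expectedError n B (2 * m + 1) i ≤
      (1 + 6 * 50000000) / (B * Real.sqrt ((2 * m + 1 : ℕ) : ℝ)) := by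
  have hB' : (2 : ℝ) ≤ B := by exact_mod_cast hB
  have hm' : (1 : ℝ) ≤ m := by exact_mod_cast hm
  have hk : (0 : ℝ) < ((2 * m + 1 : ℕ) : ℝ) := by positivity
  have hk3 : ((2 * m + 1 : ℕ) : ℝ) ≤ 3 * m := by push_cast; linarith
  set k : ℝ := ((2 * m + 1 : ℕ) : ℝ) with hkdef
  rw [expectedError_eq, div_eq_mul_one_div]
  refine expect_le_of_prob_le (fun _ => abs_nonneg _) (by positivity) (by norm_num) fun t ht => ?_
  refine (prob_lt_abs_median_le (m := m) _ (flipSign i) (rowError_flipSign _ i) _ ht.le).trans ?_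
  set q := prob (fun ρ : RowSeed n B => t < |rowError (zipf n) i ρ|) with hq
  set r := prob (fun ρ : RowSeed n B => |rowError (zipf n) i ρ| ≤ t) with hr
  have hqr : q = 1 - r := by
    rw [hr, ← prob_not]; simp only [not_le, hq]
  have hq1 : q ≤ 1 := prob_le_one _
  have hq0 : 0 ≤ q := prob_nonneg _
  have hr1 : r ≤ 1 := prob_le_one _
  have hr0 : 0 ≤ r := prob_nonneg _
  have hr2 : r ^ 2 ≤ 1 := pow_le_one₀ hr0 hr1
  have h1 := le_prob_abs_rowError_le hB i ht
  have h2 : q ≤ 48 / (t * B) := prob_lt_abs_rowError_le hB i ht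
  rw [← hr] at h1
  set x := t * B with hx
  have hx0 : 0 < x := by positivity
  have hrhs : 50000000 * (1 / (B * Real.sqrt k) / t) ^ 2 = 50000000 / (x ^ 2 * k) := by
    rw [div_div, div_pow, mul_pow, mul_pow, Real.sq_sqrt hk.le, hx]
    ring
  rw [hrhs, le_div_iff₀ (by positivity)]
  -- Up to $32$, $r\ge x/1280$ makes $(1-r^2)^m$ of order at most $1/(x^2k)$, and $q\le1$ suffices.
  rcases le_or_gt x 32 with hx32 | hx32
  · rw [min_eq_left (by linarith)] at h1
    have h3 := one_sub_pow_mul_le (sq_nonneg r) hr2 m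
    have h4 : (x / 1280) ^ 2 ≤ r ^ 2 := by
      refine pow_le_pow_left₀ (by positivity) ?_ 2
      linarith
    have h5 : 0 ≤ (1 - r ^ 2) ^ m := pow_nonneg (by linarith) m
    have h6 : x ^ 2 * k ≤ 1280 ^ 2 * 3 * (1 + m * r ^ 2) := by
      calc x ^ 2 * k ≤ x ^ 2 * (3 * m) := by gcongr
        _ = 1280 ^ 2 * 3 * (m * (x / 1280) ^ 2) := by ring
        _ ≤ 1280 ^ 2 * 3 * (1 + m * r ^ 2) := by
          have : m * (x / 1280) ^ 2 ≤ m * r ^ 2 := by gcongr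
          linarith
    calc 2 * q * (1 - r ^ 2) ^ m * (x ^ 2 * k)
        ≤ 2 * 1 * (1 - r ^ 2) ^ m * (1280 ^ 2 * 3 * (1 + m * r ^ 2)) := by gcongr
      _ = 2 * 1280 ^ 2 * 3 * ((1 - r ^ 2) ^ m * (1 + m * r ^ 2)) := by ring
      _ ≤ 50000000 := by linarith
  · rw [min_eq_right (by linarith)] at h1
    -- One factor $1-r^2\le2q$ is split off: together with the leading $q\le48/x$ it gives $x^{-2}$,
    -- and the other $d$ factors give $1/k$. This is why three rows are needed.
    obtain ⟨d, rfl⟩ : ∃ d, m = d + 1 := ⟨m - 1, by omega⟩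
    have h3 := one_sub_pow_mul_le (sq_nonneg r) hr2 d
    have h5 : 0 ≤ (1 - r ^ 2) ^ d := pow_nonneg (by linarith) d
    have h6 : k ≤ 3 * 1600 * (1 + d * r ^ 2) := by
      have h7 : (1 / 40) ^ 2 ≤ r ^ 2 := pow_le_pow_left₀ (by norm_num) h1 2
      have h8 : (d : ℝ) * (1 / 40) ^ 2 ≤ d * r ^ 2 := by gcongr
      push_cast at hk3
      linarith
    have h7 : 1 - r ^ 2 ≤ 2 * q := by rw [hqr]; nlinarith
    have h8 : q * x ≤ 48 := by rwa [le_div_iff₀ hx0] at h2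
    calc 2 * q * (1 - r ^ 2) ^ (d + 1) * (x ^ 2 * k)
        = 2 * q * ((1 - r ^ 2) ^ d * (1 - r ^ 2)) * (x ^ 2 * k) := by rw [pow_succ]
      _ ≤ 2 * q * ((1 - r ^ 2) ^ d * (2 * q)) * (x ^ 2 * (3 * 1600 * (1 + d * r ^ 2))) := by
        gcongr
      _ = 4 * 3 * 1600 * (q * x) ^ 2 * ((1 - r ^ 2) ^ d * (1 + d * r ^ 2)) := by ring
      _ ≤ 4 * 3 * 1600 * 48 ^ 2 * 1 := by
        have h9 : 0 ≤ (d : ℝ) * r ^ 2 := by positivity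
        gcongr
      _ ≤ 50000000 := by norm_num

lemma mul_prob_le_expect {α : Type*} [Fintype α] {M : α → ℝ} (hM : ∀ a, 0 ≤ M a) (t : ℝ) :
    t * prob (fun a => t < M a) ≤ 𝔼 a, M a := by
  rw [prob, Finset.mul_expect]
  refine Finset.expect_le_expect fun a _ => ?_
  split_ifs with h
  · linarith
  · simpa using hM a

lemma le_expectedError [NeZero B] (hB : 3 ≤ B) (hn : 2 * B ≤ n) (i : Fin n) :
    1 / (6 * B) * (1 / 68) ^ (2 * m + 1) ≤ expectedError n B (2 * m + 1) i := by
  rw [expectedError_eq]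
  refine le_trans ?_ (mul_prob_le_expect (fun _ => abs_nonneg _) (1 / (6 * (B : ℝ))))
  refine mul_le_mul_of_nonneg_left ?_ (by positivity)
  refine le_trans ?_ (le_prob_lt_abs_median (m := m) _ (flipSign i) (rowError_flipSign _ i) _
    (by positivity))
  have := le_prob_lt_abs_rowError hB hn i
  exact pow_le_pow_left₀ (by norm_num) (by linarith) _

lemma le_expectedError_of_large [NeZero B] (hB : 2 ≤ B) (hn : (2 * m + 1) * B ≤ n) (i : Fin n)
    (hk : 2640 ≤ Real.sqrt ((2 * m + 1 : ℕ) : ℝ)) :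
    1 / (2640 * 44) / (B * Real.sqrt ((2 * m + 1 : ℕ) : ℝ)) ≤ expectedError n B (2 * m + 1) i := by
  have hB' : (2 : ℝ) ≤ B := by exact_mod_cast hB
  have hn' : ((2 * m + 1 : ℕ) : ℝ) * B ≤ n := by exact_mod_cast hn
  set k : ℝ := ((2 * m + 1 : ℕ) : ℝ) with hkdef
  have hk0 : 0 < k := by positivity
  set w := Real.sqrt k with hw
  have hw0 : 0 < w := by linarith
  have hwk : w * w = k := Real.mul_self_sqrt hk0.le
  -- Chosen so that $r\le120\,tB=1/(22w)$. With $\theta=1/w$ the random walk gains at least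
  -- $(1-10/11)/2=1/22$ and the small entries cost at most $1/44$.
  set t : ℝ := 1 / (2640 * (B * w)) with ht
  have ht0 : 0 < t := by positivity
  rw [expectedError_eq]
  refine le_trans ?_ (mul_prob_le_expect (fun _ => abs_nonneg _) t)
  have h1 : t * (1 / 44) = 1 / (2640 * 44) / (B * w) := by rw [ht]; field_simp
  rw [← h1]
  refine mul_le_mul_of_nonneg_left ?_ ht0.le
  refine le_trans ?_ (le_prob_lt_abs_median_of_cos (m := m) _ (flipSign i) (rowError_flipSign _ i) _
    ht0.le (θ := 1 / w) (by positivity))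
  set q := prob (fun ρ : RowSeed n B => t < |rowError (zipf n) i ρ|) with hq
  set r := prob (fun ρ : RowSeed n B => |rowError (zipf n) i ρ| ≤ t) with hr
  have hqr : q = 1 - r := by
    rw [hr, ← prob_not]; simp only [not_le, hq]
  have hrle : r ≤ 1 / (22 * w) := by
    refine (prob_abs_rowError_le hB i ht0 ?_).trans (le_of_eq ?_)
    -- The anti-concentration bound requires $1/t=2640Bw\le n$, which follows from $w^2B=kB\le n$
    -- and $w\ge2640$.
    · rw [ht, one_div_one_div]
      refine le_trans ?_ hn'
      rw [← hwk]
      nlinarith [mul_pos hw0 (by linarith : (0 : ℝ) < B)]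
    · rw [ht]; field_simp; norm_num
  have hw1 : 1 / (22 * w) ≤ 1 / 2 := one_div_le_one_div_of_le two_pos (by linarith)
  have hq2 : 1 / 2 ≤ q := by linarith
  have hq1 : q ≤ 1 := prob_le_one _
  have hθ1 : 1 / w ≤ 1 := by rw [div_le_one hw0]; linarith
  have hθ0 : 0 < 1 / w := by positivity
  have hcos : 1 / (5 * k) ≤ 1 - Real.cos (1 / w) := by
    have h3 := Real.cos_le_one_sub_mul_cos_sq (x := 1 / w)
      (by rw [abs_of_pos hθ0]; linarith [Real.pi_gt_three])
    have h4 : 1 / 5 ≤ 2 / Real.pi ^ 2 := by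
      rw [div_le_div_iff₀ (by norm_num) (by positivity)]
      nlinarith [Real.pi_lt_d2, Real.pi_pos]
    have h5 : (1 / w) ^ 2 = 1 / k := by rw [← hwk]; field_simp
    rw [h5] at h3
    have h6 : 1 / 5 * (1 / k) ≤ 2 / Real.pi ^ 2 * (1 / k) := by gcongr
    have h7 : 1 / (5 * k) = 1 / 5 * (1 / k) := by field_simp
    linarith
  have hcos2 : 1 - Real.cos (1 / w) ≤ 1 := by
    linarith [Real.cos_nonneg_of_neg_pi_div_two_le_of_le (x := 1 / w)
      (by linarith [Real.pi_pos]) (by linarith [Real.pi_gt_three])]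
  have hpow : (1 - q * (1 - Real.cos (1 / w))) ^ (2 * m + 1) ≤ 10 / 11 := by
    have h3 : 1 / (10 * k) ≤ q * (1 - Real.cos (1 / w)) :=
      calc 1 / (10 * k) = 1 / 2 * (1 / (5 * k)) := by field_simp; norm_num
        _ ≤ _ := by gcongr
    have h4 : 1 - q * (1 - Real.cos (1 / w)) ≤ Real.exp (-(1 / (10 * k))) := by
      linarith [Real.add_one_le_exp (-(1 / (10 * k)))]
    calc (1 - q * (1 - Real.cos (1 / w))) ^ (2 * m + 1)
        ≤ Real.exp (-(1 / (10 * k))) ^ (2 * m + 1) :=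
          pow_le_pow_left₀ (by nlinarith [Real.cos_le_one (1 / w)]) h4 _
      _ = (Real.exp (1 / 10))⁻¹ := by
        rw [← Real.exp_nat_mul, ← Real.exp_neg, ← hkdef]
        congr 1
        field_simp
      _ ≤ 10 / 11 := by
        rw [inv_le_comm₀ (Real.exp_pos _) (by norm_num)]
        linarith [Real.add_one_le_exp (1 / 10 : ℝ)]
  have hr3 : 1 / w / 2 * ((2 * m + 1) * r) ≤ 1 / 44 :=
    calc 1 / w / 2 * ((2 * m + 1) * r) = 1 / w / 2 * (k * r) := by rw [hkdef]; push_cast; ring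
      _ ≤ 1 / w / 2 * (k * (1 / (22 * w))) := by gcongr
      _ = 1 / 44 := by rw [← hwk]; field_simp; norm_num
  linarith

lemma one_le_log {k : ℕ} (hk : 3 ≤ k) : 1 ≤ Real.log k := by
  have hk' : (3 : ℝ) ≤ k := by exact_mod_cast hk
  rw [Real.le_log_iff_exp_le (by linarith)]
  linarith [Real.exp_one_lt_d9]

/-- The expected error of CountSketch, up to constants and a logarithmic factor. -/
lemma exists_expectedError_bounds : ∃ c C : ℝ, 0 < c ∧ 0 < C ∧
    ∀ n B k : ℕ, Odd k → 3 ≤ k → k ≤ B → k * B ≤ n → ∀ i : Fin n,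
      c / ((B : ℝ) * Real.sqrt (k : ℝ) * Real.log (k : ℝ)) ≤ expectedError n B k i ∧
      expectedError n B k i ≤ C / ((B : ℝ) * Real.sqrt (k : ℝ)) := by
  -- Below this threshold on $k$ the exponentially small factor $68^{-k}$ is at least the constant
  -- $68^{-K}$.
  obtain ⟨K, hK⟩ : ∃ K : ℕ, (2640 : ℝ) ^ 2 ≤ K := exists_nat_ge _
  refine ⟨min (1 / (2640 * 44)) (1 / 6 * (1 / 68) ^ K), 1 + 6 * 50000000,
    lt_min (by norm_num) (by positivity), by norm_num, ?_⟩
  intro n B k hodd hk3 hkB hn i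
  have : NeZero B := ⟨by omega⟩
  have hB' : (0 : ℝ) < B := by exact_mod_cast (show 0 < B by omega)
  have hlog := one_le_log hk3
  have hsqrt : 1 ≤ Real.sqrt k := by
    rw [Real.one_le_sqrt]
    exact_mod_cast (show 1 ≤ k by omega)
  obtain ⟨m, rfl⟩ := hodd
  refine ⟨?_, expectedError_le (by omega) (by omega) i⟩
  by_cases hlarge : 2640 ≤ Real.sqrt ((2 * m + 1 : ℕ) : ℝ)
  · refine le_trans ?_ (le_expectedError_of_large (by omega) hn i hlarge)
    refine div_le_div₀ (by norm_num) (min_le_left _ _) (by positivity) ?_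
    exact le_mul_of_one_le_right (by positivity) hlog
  · have hkK : 2 * m + 1 ≤ K := by
      have h1 : ((2 * m + 1 : ℕ) : ℝ) < 2640 ^ 2 :=
        (Real.sqrt_lt' (by norm_num)).1 (not_le.1 hlarge)
      exact_mod_cast (h1.trans_le hK).le
    refine le_trans ?_ (le_expectedError (by omega)
      (le_trans (Nat.mul_le_mul_right B (by omega)) hn) i)
    have h2 : 1 / (6 * (B : ℝ)) * (1 / 68) ^ (2 * m + 1) = 1 / 6 * (1 / 68) ^ (2 * m + 1) / B := by
      field_simp
    rw [h2]
    refine div_le_div₀ (by positivity) ((min_le_right _ _).trans ?_) hB' ?_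
    · refine mul_le_mul_of_nonneg_left ?_ (by norm_num)
      exact pow_le_pow_of_le_one (by norm_num) (by norm_num) hkK
    · rw [mul_assoc]
      exact le_mul_of_one_le_right hB'.le (one_le_mul_of_one_le_of_one_le hsqrt hlog)

lemma expectedWeightedError_eq (n B k : ℕ) : expectedWeightedError n B k =
    (1 / ∑ i, zipf n i) * ∑ i, zipf n i * expectedError n B k i := by
  unfold expectedWeightedError expectedError
  rw [← Finset.mul_expect, Finset.expect_sum_comm]
  simp only [Finset.mul_expect]

end Bounds

end CountSketch

/-! ### Comparison of row counts at fixed space -/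

theorem theoremC4 :
    (∃ c C : ℝ, 0 < c ∧ 0 < C ∧
      ∀ n B k : ℕ, Odd k → 3 ≤ k → k ≤ B → k * B ≤ n → ∀ i : Fin n,
        c / ((B : ℝ) * Real.sqrt (k : ℝ) * Real.log (k : ℝ)) ≤ CountSketch.expectedError n B k i ∧
        CountSketch.expectedError n B k i ≤ C / ((B : ℝ) * Real.sqrt (k : ℝ))) ∧
    (∀ k₀ : ℕ, Odd k₀ → 3 ≤ k₀ → ∃ D : ℝ, 0 < D ∧
      ∀ n S : ℕ, S ≤ n → k₀ ≤ S / k₀ →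
        ∀ k : ℕ, Odd k → 3 ≤ k → k ≤ S / k →
          (∀ i : Fin n,
            CountSketch.expectedError n (S / k₀) k₀ i ≤
              D * CountSketch.expectedError n (S / k) k i) ∧
          CountSketch.expectedWeightedError n (S / k₀) k₀ ≤
            D * CountSketch.expectedWeightedError n (S / k) k) := by
  refine ⟨CountSketch.exists_expectedError_bounds, ?_⟩
  obtain ⟨c, C, hc, hC, hbounds⟩ := CountSketch.exists_expectedError_bounds
  intro k₀ hodd₀ hk₀
  have hk₀' : (3 : ℝ) ≤ k₀ := by exact_mod_cast hk₀
  refine ⟨4 * k₀ * C / c, by positivity, ?_⟩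
  intro n S hSn hkS₀ k hodd hk hkS
  have hk' : (3 : ℝ) ≤ k := by exact_mod_cast hk
  have hmain : ∀ i : Fin n, CountSketch.expectedError n (S / k₀) k₀ i ≤
      4 * k₀ * C / c * CountSketch.expectedError n (S / k) k i := by
    intro i
    have h1 := (hbounds n (S / k₀) k₀ hodd₀ hk₀ hkS₀ ((Nat.mul_div_le S k₀).trans hSn) i).2
    have h2 := (hbounds n (S / k) k hodd hk hkS ((Nat.mul_div_le S k).trans hSn) i).1
    refine h1.trans (le_trans ?_ (mul_le_mul_of_nonneg_left h2 (by positivity)))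
    have hB₀ : (3 : ℝ) ≤ ((S / k₀ : ℕ) : ℝ) := by exact_mod_cast hk₀.trans hkS₀
    have hB : (3 : ℝ) ≤ ((S / k : ℕ) : ℝ) := by exact_mod_cast hk.trans hkS
    -- Rounding down costs at most a factor $2$, as the quotient is at least $1$.
    have hS₀ : (S : ℝ) ≤ 2 * k₀ * ((S / k₀ : ℕ) : ℝ) := by
      have h3 : S < k₀ * (S / k₀ + 1) := Nat.lt_mul_div_succ S (by omega)
      have h4 : (S : ℝ) < k₀ * (((S / k₀ : ℕ) : ℝ) + 1) := by exact_mod_cast h3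
      nlinarith
    have hS : (k : ℝ) * ((S / k : ℕ) : ℝ) ≤ S := by exact_mod_cast Nat.mul_div_le S k
    set B₀ : ℝ := ((S / k₀ : ℕ) : ℝ)
    set B : ℝ := ((S / k : ℕ) : ℝ)
    have hw : Real.sqrt k * Real.sqrt k = k := Real.mul_self_sqrt (by positivity)
    have hw1 : 1 ≤ Real.sqrt k := by rw [Real.one_le_sqrt]; linarith
    have hw₀ : 1 ≤ Real.sqrt k₀ := by rw [Real.one_le_sqrt]; linarith
    have hlog1 := CountSketch.one_le_log hk
    have hlog : Real.log k ≤ 2 * Real.sqrt k := by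
      have h5 := Real.log_le_sub_one_of_pos (x := Real.sqrt k) (by linarith)
      rw [Real.log_sqrt (by positivity)] at h5
      linarith
    have h6 : 4 * k₀ * C / c * (c / (B * Real.sqrt k * Real.log k)) =
        4 * k₀ * C / (B * Real.sqrt k * Real.log k) := by field_simp
    rw [h6, div_le_div_iff₀ (by positivity) (by positivity)]
    -- Both sides are compared through $S$: the left is at most $2kB\le2S$, and $S\le2k_0B_0$. This
    -- removes $k$ and yields the $4k_0$ in $D$.
    have h7 : B * Real.sqrt k * Real.log k ≤ 4 * k₀ * B₀ :=
      calc B * Real.sqrt k * Real.log k ≤ B * Real.sqrt k * (2 * Real.sqrt k) := by gcongr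
        _ = 2 * (Real.sqrt k * Real.sqrt k * B) := by ring
        _ = 2 * (k * B) := by rw [hw]
        _ ≤ 4 * k₀ * B₀ := by linarith
    calc C * (B * Real.sqrt k * Real.log k) ≤ C * (4 * k₀ * B₀) := by gcongr
      _ ≤ C * (4 * k₀ * B₀) * Real.sqrt k₀ := le_mul_of_one_le_right (by positivity) hw₀
      _ = 4 * k₀ * C * (B₀ * Real.sqrt k₀) := by ring
  refine ⟨hmain, ?_⟩
  have hz : ∀ i : Fin n, 0 ≤ CountSketch.zipf n i := fun i => by
    unfold CountSketch.zipf; positivity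
  rw [CountSketch.expectedWeightedError_eq, CountSketch.expectedWeightedError_eq, mul_left_comm,
    Finset.mul_sum (a := 4 * k₀ * C / c)]
  refine mul_le_mul_of_nonneg_left (Finset.sum_le_sum fun i _ => ?_)
    (one_div_nonneg.2 (Finset.sum_nonneg fun i _ => hz i))
  rw [mul_left_comm]
  exact mul_le_mul_of_nonneg_left (hmain i) (hz i)
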